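/- **Conventions.** A CountSketch with $k$ rows, positions $p:[n]\to[k]$ and signs $\sigma\in\{\pm1\}^n$ is the matrix $S=\mathrm{CS}(p,\sigma)\in\mathbb{R}^{k\times n}$ whose $i$-th column has the single nonzero entry $\sigma_i$, in row $p(i)$. For $A\in\mathbb{R}^{n\times d}$ put $$\mathrm{err}_k(S,A)=\min\{\|X-A\|_F^2 : \operatorname{rank}X\le k,\ \text{every row of } X \text{ lies in } \mathrm{rowsp}(SA)\}.$$ *Greedy position optimization* on training matrices $A_1,\dots,A_N\in\mathbb{R}^{n\times d}$ ($N\ge1$) starts from $S=0\in\mathbb{R}^{k\times n}$ and processes the indices $i\in[n]$ in an order in which the row norms of each training matrix are non-increasing; for the current index $i$, with sign $\sigma_i\in\{\pm1\}$, it chooses $j\in[k]$ minimizing $\sum_{a=1}^N\mathrm{err}_k(S+\sigma_i e_je_i^{\top},A_a)$ and adds $\sigma_i e_je_i^{\top}$ to $S$. Ties (in the order and in the minimum) are broken arbitrarily, and the signs are arbitrary; they may, for instance, be optimized together with $j$. Every possible final matrix $S$ is called a greedy sketch. *Spiked covariance model* $\mathcal{A}_{sp}(R,\ell)$, for $R\subseteq[n]$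 and $\ell>1$: the law of the matrix $A\in\mathbb{R}^{n\times d}$ with rows $A_i=\ell v_i$ for $i\in R$ and $A_i=v_i$ for $i\notin R$, where $v_1,\dots,v_n$ are independent and uniformly distributed on the unit sphere of $\mathbb{R}^d$. *Zipfian model* $\mathcal{A}_{zipf}(c)$: for $h\ge0$ and a map $c:[n]\to\{1,\dots,h\}$ with $|c^{-1}(i)|=2^{i+1}$ for $1\le i\le h$ (so $n=2^{h+2}-4$), the family of all $A\in\mathbb{R}^{n\times d}$ with pairwise orthogonal rows satisfying $\|A_r\|_2^2=n^2/2^{2c(r)}$ for all $r\in[n]$. **Theorem.** There is an absolute constant $\eta>0$ for which both of the following hold. 1. (Spiked covariance model.) For every $q\in\mathbb{N}$ there is $C>0$, depending only on $q$, such that the following holds. Let $k\ge2$, $0.7<\alpha<1$, let $s=\alpha(k-1)$ be an integer, let $\ell>1$ satisfy $\ell^2\ge\frac{(4e+1)n}{\alpha k}$ (which is the case if $\ell\ge\frac{(4e+1)n}{\alpha k}$), let $d\ge C\,n^6\ell^2$, and let $R\subseteq[n]$ with $|R|=s$. Let $A_1,\dots,A_N$ ($N\ge1$) and $A$ be random matrices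 on a common probability space, each with law $\mathcal{A}_{sp}(R,\ell)$; their joint law is arbitrary (they may be independent, or $N=1$ and $A_1=A$). Then, except on an event of (outer) probability at most $(N+1)/n^{q}$, for every greedy sketch $S_L$ on $A_1,\dots,A_N$ and all signs $\tau\in\{\pm1\}^n$, $$\mathrm{err}_k(S_L,A)\le(1-\eta)\;\mathbf{E}_{p}\big[\mathrm{err}_k(\mathrm{CS}(p,\tau),A)\big],$$ where the expectation is over positions $p:[n]\to[k]$ chosen uniformly at random ($A$ being fixed). 2. (Zipfian model.) There is $k_0$ such that for all $k\ge k_0$, all $n,d,h$ and $c$ as in the definition of the Zipfian model, all $N\ge1$ and all $A_1,\dots,A_N,A\in\mathcal{A}_{zipf}(c)$, every greedy sketch $S_L$ on $A_1,\dots,A_N$ and all signs $\tau\in\{\pm1\}^n$ satisfy $$\mathrm{err}_k(S_L,A)\le(1-\eta)\;\mathbf{E}_{p}\big[\mathrm{err}_k(\mathrm{CS}(p,\tau),A)\big].$$ In particular this holds almost surely when the row directions of the matrices are uniformly random orthonormal systems. -/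

import Mathlib

open MeasureTheory ProbabilityTheory

noncomputable section

/-! ### CountSketch matrices and the low rank approximation error -/

/-- The CountSketch matrix with positions `p` and signs `σ`: column `i` has the single nonzero
entry `σ i`, in row `p i`. -/
def countSketch {m n : ℕ} (p : Fin n → Fin m) (σ : Fin n → ℤˣ) : Matrix (Fin m) (Fin n) ℝ :=
  Matrix.of fun j i => if p i = j then ((σ i : ℤ) : ℝ) else 0

/-- Squared Frobenius norm. -/
def frobSq {n d : ℕ} (M : Matrix (Fin n) (Fin d) ℝ) : ℝ :=
  ∑ i, ∑ j, M i j ^ 2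

/-- The error `min ‖X - A‖_F²` over all `X` of rank at most `k` with rows in the row space of
`S * A`. -/
def sketchErr {m n d : ℕ} (k : ℕ) (S : Matrix (Fin m) (Fin n) ℝ)
    (A : Matrix (Fin n) (Fin d) ℝ) : ℝ :=
  sInf {e : ℝ | ∃ X : Matrix (Fin n) (Fin d) ℝ, X.rank ≤ k ∧
    (∀ i, X.row i ∈ Submodule.span ℝ (Set.range (S * A).row)) ∧ e = frobSq (X - A)}

/-- The expected rank-`k` error in the row space of `S * A`, where `S` is a CountSketch with
`m` rows, signs `τ`, and positions chosen uniformly at random. -/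
def expectedRandomErr {n d : ℕ} (k m : ℕ) (τ : Fin n → ℤˣ)
    (A : Matrix (Fin n) (Fin d) ℝ) : ℝ :=
  (∑ q : Fin n → Fin m, sketchErr k (countSketch q τ) A) / (Fintype.card (Fin n → Fin m) : ℝ)

/-! ### Greedy position optimization -/

/-- The sketch built after `t` iterations, when the columns are processed in the order
`π 0, π 1, …`: only the columns processed so far are nonzero. -/
def partialSketch {m n : ℕ} (π : Equiv.Perm (Fin n)) (p : Fin n → Fin m) (σ : Fin n → ℤˣ)
    (t : ℕ) : Matrix (Fin m) (Fin n) ℝ :=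
  Matrix.of fun j i => if (π.symm i : ℕ) < t then countSketch p σ j i else 0

/-- Squared Euclidean norm of a row. -/
def rowNormSq {n d : ℕ} (A : Matrix (Fin n) (Fin d) ℝ) (i : Fin n) : ℝ :=
  ∑ j, A i j ^ 2

/-- `p` and `σ` are the positions and signs of a sketch that greedy position optimization, with
rows processed in the order `π`, can return on the training matrices `Tr`: the order is
non-increasing in the row norms, and in iteration `t` the position of the nonzero entry of column
`π t` minimizes the total rank-`k` error of the half-built sketch over the training matrices.
Ties may be broken, and signs may be chosen, in any way; in particular the outcomes where the
sign is optimized together with the position are included. -/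
structure IsGreedy {N m n d : ℕ} (k : ℕ) (Tr : Fin N → Matrix (Fin n) (Fin d) ℝ)
    (π : Equiv.Perm (Fin n)) (p : Fin n → Fin m) (σ : Fin n → ℤˣ) : Prop where
  order : ∀ a, Antitone fun t => rowNormSq (Tr a) (π t)
  argmin : ∀ (t : Fin n) (j : Fin m),
    ∑ a, sketchErr k (partialSketch π p σ t +
        Matrix.single (p (π t)) (π t) ((σ (π t) : ℤ) : ℝ)) (Tr a) ≤
      ∑ a, sketchErr k (partialSketch π p σ t +
        Matrix.single j (π t) ((σ (π t) : ℤ) : ℝ)) (Tr a)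

/-! ### The spiked covariance model -/

/-- The uniform probability measure on the unit sphere of `ℝ^d` (for `d ≥ 1`). -/
def uniformSphere (d : ℕ) : Measure (Metric.sphere (0 : EuclideanSpace ℝ (Fin d)) 1) :=
  ((volume : Measure (EuclideanSpace ℝ (Fin d))).toSphere Set.univ)⁻¹ •
    (volume : Measure (EuclideanSpace ℝ (Fin d))).toSphere

/-- The law of the `n × d` matrix whose rows are `ℓ • v i` for `i ∈ R` and `v i` for `i ∉ R`,
where the `v i` are independent uniformly random unit vectors. -/
def spikedLaw {n : ℕ} (d : ℕ) (R : Finset (Fin n)) (ℓ : ℝ) : Measure (Fin n → Fin d → ℝ) :=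
  (Measure.pi fun _ : Fin n => uniformSphere d).map fun v i j =>
    (if i ∈ R then ℓ else 1) * (v i : EuclideanSpace ℝ (Fin d)) j

/-! ### The Zipfian model -/

/-- `c` partitions the `n` row indices into classes `1, …, h`, class `i` having `2 ^ (i + 1)`
members; hence `n = 2 ^ (h + 2) - 4`. -/
def IsZipfProfile {n : ℕ} (h : ℕ) (c : Fin n → ℕ) : Prop :=
  (∀ r, c r ∈ Finset.Icc 1 h) ∧
    ∀ i ∈ Finset.Icc 1 h, (Finset.univ.filter fun r => c r = i).card = 2 ^ (i + 1)

/-- `A` has pairwise orthogonal rows, those of class `i` having squared norm `n² / 2^(2i)`. -/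
structure IsZipf {n d : ℕ} (c : Fin n → ℕ) (A : Matrix (Fin n) (Fin d) ℝ) : Prop where
  norm_sq : ∀ r, rowNormSq A r = (n : ℝ) ^ 2 / 2 ^ (2 * c r)
  orthogonal : ∀ r r', r ≠ r' → ∑ j, A r j * A r' j = 0

end

/-! For orthogonal rows with squared norms `w`, the error decouples over buckets: a sketched row `i`
whose bucket has total weight `W` loses `w i - w i ^ 2 / W`. For nearly orthogonal rows this remains
true up to factors `1 ± δ` (`le_sketchErr`, `sketchErr_le`).

Greedy: an empty bucket captures the whole weight of the new row, while a collision with an earlier,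
no lighter row gains nothing. So the first `k` rows land in distinct buckets (`processed_injOn`),
and the final error is at most twice the weight of the remaining rows (`orthErr_univ_le`).

Random: a bucket captures at most its heaviest row (`orthErr_ge`), and among a set of `H ≤ k` heavy
rows, collisions waste on average at least `H (H - 1) / (3 k)` of them (`sum_card_image_le`). In the
spiked model this costs at least `1.15 n`, so the average is at least `2.15 (n - k)` against `2 (n -
k)` for greedy. In the Zipfian model each dyadic level that fits into `k` buckets costs about `n ^ 2
/ k`, so the average exceeds the tail weight by a factor of order `log k`.

Probability enters only through near-orthogonality: a spherical cap bound controls the inner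
products of independent unit vectors, and a union bound over the matrices ignores their joint law.
-/

/-- The CountSketch matrix in which only the columns in `T` are kept. -/
def restrictedSketch {m n : ℕ} (T : Finset (Fin n)) (p : Fin n → Fin m) (σ : Fin n → ℤˣ) :
    Matrix (Fin m) (Fin n) ℝ :=
  Matrix.of fun j i => if i ∈ T ∧ p i = j then ((σ i : ℤ) : ℝ) else 0

/-- Total weight of the columns in `T` that share the bucket of `i`. -/
def bucketWeight {m n : ℕ} (w : Fin n → ℝ) (T : Finset (Fin n)) (p : Fin n → Fin m)
    (i : Fin n) : ℝ :=
  ∑ l ∈ T with p l = p i, w l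

/-- The error of the sketch `restrictedSketch T p σ` on a matrix with pairwise orthogonal rows of
squared norms `w`. -/
noncomputable def orthErr {m n : ℕ} (w : Fin n → ℝ) (T : Finset (Fin n)) (p : Fin n → Fin m) : ℝ :=
  ∑ i, w i - ∑ i ∈ T, w i ^ 2 / bucketWeight w T p i

/-- The rows of `A` are orthogonal with squared norms `w`, up to a relative error `δ`. -/
def NearOrth {n d : ℕ} (δ : ℝ) (w : Fin n → ℝ) (A : Matrix (Fin n) (Fin d) ℝ) : Prop :=
  ∀ c : Fin n → ℝ, (1 - δ) * ∑ i, w i * c i ^ 2 ≤ ∑ j, (∑ i, c i * A i j) ^ 2 ∧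
    ∑ j, (∑ i, c i * A i j) ^ 2 ≤ (1 + δ) * ∑ i, w i * c i ^ 2

lemma sign_sq (u : ℤˣ) : (((u : ℤ) : ℝ)) ^ 2 = 1 := by
  rcases Int.units_eq_one_or u with h | h <;> simp [h]

/-! ### Sketch errors for nearly orthogonal rows. -/

section Weights

variable {m n d : ℕ} {w : Fin n → ℝ} {T : Finset (Fin n)} {p : Fin n → Fin m}

lemma le_bucketWeight (hw : ∀ i, 0 < w i) {i : Fin n} (hi : i ∈ T) :
    w i ≤ bucketWeight w T p i :=
  Finset.single_le_sum (f := w) (fun l _ => (hw l).le) (by simp [hi])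

lemma sum_bucket (y σi : ℝ) (σ : Fin n → ℤˣ) {i : Fin n} (hi : i ∈ T)
    (hσ : σi = ((σ i : ℤ) : ℝ)) :
    ∑ l ∈ T with p l = p i, w l * (((σ l : ℤ) : ℝ) * y - if l = i then 1 else 0) ^ 2 =
      bucketWeight w T p i * y ^ 2 + w i * (1 - 2 * σi * y) := by
  have h : ∀ l ∈ T.filter (fun l => p l = p i),
      w l * (((σ l : ℤ) : ℝ) * y - if l = i then 1 else 0) ^ 2 =
        w l * y ^ 2 + if l = i then w i * (1 - 2 * σi * y) else 0 := by
    intro l _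
    have h1 := sign_sq (σ l)
    split_ifs with h
    · subst h
      rw [hσ]
      linear_combination (w l * y ^ 2) * h1
    · linear_combination (w l * y ^ 2) * h1
  rw [Finset.sum_congr rfl h, Finset.sum_add_distrib, ← Finset.sum_mul, Finset.sum_ite_eq']
  simp [hi, bucketWeight]

/-- Terms outside the bucket of `i` are non-negative; inside it a single unknown `y (p i)` remains,
and completing the square gives the minimum. -/
lemma row_err_ge (hw : ∀ i, 0 < w i) (σ : Fin n → ℤˣ) (y : Fin m → ℝ) (i : Fin n) :
    (w i - if i ∈ T then w i ^ 2 / bucketWeight w T p i else 0) ≤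
      ∑ l, w l * ((if l ∈ T then ((σ l : ℤ) : ℝ) * y (p l) else 0) -
        if l = i then 1 else 0) ^ 2 := by
  have hnn : ∀ l, 0 ≤ w l * ((if l ∈ T then ((σ l : ℤ) : ℝ) * y (p l) else 0) -
        if l = i then 1 else 0) ^ 2 := fun l => mul_nonneg (hw l).le (sq_nonneg _)
  by_cases hi : i ∈ T
  · calc _ ≤ bucketWeight w T p i * y (p i) ^ 2 +
          w i * (1 - 2 * ((σ i : ℤ) : ℝ) * y (p i)) := by
          have hW : 0 < bucketWeight w T p i := (hw i).trans_le (le_bucketWeight hw hi)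
          have h1 := sign_sq (σ i)
          rw [if_pos hi, ← sub_nonneg]
          have : bucketWeight w T p i * y (p i) ^ 2 + w i * (1 - 2 * ((σ i : ℤ) : ℝ) * y (p i)) -
              (w i - w i ^ 2 / bucketWeight w T p i) =
              (bucketWeight w T p i * y (p i) - w i * ((σ i : ℤ) : ℝ)) ^ 2 /
                bucketWeight w T p i := by
            field_simp
            linear_combination (-w i ^ 2) * h1
          rw [this]
          positivity
      _ = ∑ l ∈ T with p l = p i,
          w l * (((σ l : ℤ) : ℝ) * y (p i) - if l = i then 1 else 0) ^ 2 :=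
          (sum_bucket _ _ σ hi rfl).symm
      _ = ∑ l ∈ T with p l = p i, w l * ((if l ∈ T then ((σ l : ℤ) : ℝ) * y (p l) else 0) -
            if l = i then 1 else 0) ^ 2 := by
          refine Finset.sum_congr rfl fun l hl => ?_
          rw [Finset.mem_filter] at hl
          rw [if_pos hl.1, hl.2]
      _ ≤ _ := Finset.sum_le_univ_sum_of_nonneg hnn
  · have := Finset.single_le_sum (fun l _ => hnn l) (Finset.mem_univ i)
    simpa [hi] using this

lemma exists_row_err_le (hw : ∀ i, 0 < w i) (σ : Fin n → ℤˣ) (i : Fin n) :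
    ∃ y : Fin m → ℝ, ∑ l, w l * ((if l ∈ T then ((σ l : ℤ) : ℝ) * y (p l) else 0) -
        if l = i then 1 else 0) ^ 2 =
      w i - if i ∈ T then w i ^ 2 / bucketWeight w T p i else 0 := by
  by_cases hi : i ∈ T
  · have hW : 0 < bucketWeight w T p i := (hw i).trans_le (le_bucketWeight hw hi)
    -- The minimizer of the quadratic in `sum_bucket`.
    set y₀ : ℝ := ((σ i : ℤ) : ℝ) * w i / bucketWeight w T p i with hy₀
    refine ⟨fun j => if j = p i then y₀ else 0, ?_⟩
    calc _ = ∑ l ∈ T with p l = p i,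
          w l * (((σ l : ℤ) : ℝ) * y₀ - if l = i then 1 else 0) ^ 2 := by
          rw [Finset.sum_filter, ← Finset.sum_filter_add_sum_filter_not Finset.univ (· ∈ T)]
          have h0 : ∑ l with l ∉ T, w l * ((if l ∈ T then ((σ l : ℤ) : ℝ) *
              (if p l = p i then y₀ else 0) else 0) - if l = i then 1 else 0) ^ 2 = 0 := by
            refine Finset.sum_eq_zero fun l hl => ?_
            have hl : l ∉ T := by simpa using hl
            have : l ≠ i := fun h => hl (h ▸ hi)
            simp [hl, this]
          rw [h0, add_zero, Finset.filter_univ_mem]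
          refine Finset.sum_congr rfl fun l hl => ?_
          by_cases hp : p l = p i
          · simp [hl, hp]
          · have : l ≠ i := fun h => hp (h ▸ rfl)
            simp [hp, this]
      _ = _ := by
          have h1 := sign_sq (σ i)
          rw [sum_bucket _ _ σ hi rfl, if_pos hi, hy₀]
          field_simp
          linear_combination (- w i ^ 2) * h1
  · refine ⟨fun _ => 0, ?_⟩
    simp [hi]

lemma orthErr_eq_sum :
    orthErr w T p = ∑ i, (w i - if i ∈ T then w i ^ 2 / bucketWeight w T p i else 0) := by
  rw [orthErr, Finset.sum_sub_distrib]
  simp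

lemma mul_restrictedSketch_apply (Y : Matrix (Fin n) (Fin m) ℝ) (σ : Fin n → ℤˣ)
    (i l : Fin n) :
    (Y * restrictedSketch T p σ) i l = if l ∈ T then ((σ l : ℤ) : ℝ) * Y i (p l) else 0 := by
  by_cases hl : l ∈ T <;> simp [Matrix.mul_apply, restrictedSketch, hl, mul_comm]

lemma frobSq_sub_eq (Y : Matrix (Fin n) (Fin m) ℝ) (S : Matrix (Fin m) (Fin n) ℝ)
    (A : Matrix (Fin n) (Fin d) ℝ) :
    frobSq (Y * (S * A) - A) =
      ∑ i, ∑ j, (∑ l, ((Y * S) i l - if l = i then 1 else 0) * A l j) ^ 2 := by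
  refine Finset.sum_congr rfl fun i _ => Finset.sum_congr rfl fun j _ => ?_
  rw [← Matrix.mul_assoc, Matrix.sub_apply, Matrix.mul_apply]
  simp [sub_mul, Finset.sum_sub_distrib]

lemma frobSq_nonneg (M : Matrix (Fin n) (Fin d) ℝ) : 0 ≤ frobSq M :=
  Finset.sum_nonneg fun _ _ => Finset.sum_nonneg fun _ _ => sq_nonneg _

lemma exists_eq_mul_of_row_mem_span (M : Matrix (Fin m) (Fin d) ℝ)
    (X : Matrix (Fin n) (Fin d) ℝ) (hX : ∀ i, X.row i ∈ Submodule.span ℝ (Set.range M.row)) :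
    ∃ Y : Matrix (Fin n) (Fin m) ℝ, X = Y * M := by
  have h : ∀ i, ∃ y : Fin m → ℝ, ∑ j, y j • M.row j = X.row i := fun i =>
    (Submodule.mem_span_range_iff_exists_fun ℝ).1 (hX i)
  choose y hy using h
  refine ⟨Matrix.of y, ?_⟩
  ext i j
  have := congrFun (hy i) j
  simpa [Matrix.mul_apply, eq_comm] using this

/-- Dropping the rank bound only enlarges the set of competitors `Y * (S * A)`, whose rows can then
be treated independently. -/
lemma le_sketchErr {δ : ℝ} (hδ : δ ≤ 1) {A : Matrix (Fin n) (Fin d) ℝ}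
    (hA : NearOrth δ w A) (hw : ∀ i, 0 < w i) (σ : Fin n → ℤˣ) (k : ℕ) :
    (1 - δ) * orthErr w T p ≤ sketchErr k (restrictedSketch T p σ) A := by
  refine le_csInf ⟨_, 0, by simp, fun i => ?_, rfl⟩ ?_
  · exact Submodule.zero_mem _
  · rintro _ ⟨X, -, hX, rfl⟩
    obtain ⟨Y, rfl⟩ := exists_eq_mul_of_row_mem_span _ X hX
    rw [frobSq_sub_eq, orthErr_eq_sum, Finset.mul_sum]
    refine Finset.sum_le_sum fun i _ => le_trans ?_ (hA _).1
    refine mul_le_mul_of_nonneg_left ?_ (by linarith)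
    simp only [mul_restrictedSketch_apply]
    exact row_err_ge hw σ (Y i) i

/-- The sketch has as many rows as the permitted rank, so the rank constraint is automatic and each
row of `Y` can be chosen optimally. -/
lemma sketchErr_le {δ : ℝ} {A : Matrix (Fin n) (Fin d) ℝ}
    (hA : NearOrth δ w A) (hw : ∀ i, 0 < w i) (σ : Fin n → ℤˣ) :
    sketchErr m (restrictedSketch T p σ) A ≤ (1 + δ) * orthErr w T p := by
  choose y hy using exists_row_err_le (T := T) (p := p) hw σ
  refine le_trans (csInf_le ⟨0, ?_⟩ ⟨Matrix.of y * (restrictedSketch T p σ * A), ?_, ?_, rfl⟩) ?_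
  · rintro _ ⟨X, -, -, rfl⟩
    exact frobSq_nonneg _
  · exact (Matrix.rank_mul_le_left _ _).trans
      ((Matrix.rank_le_card_width _).trans (by simp))
  · intro i
    refine (Submodule.mem_span_range_iff_exists_fun ℝ).2 ⟨y i, ?_⟩
    ext j
    simp [Matrix.mul_apply]
  · rw [frobSq_sub_eq, orthErr_eq_sum, Finset.mul_sum]
    refine Finset.sum_le_sum fun i _ => le_trans (hA _).2 (le_of_eq ?_)
    rw [← hy i]
    simp only [mul_restrictedSketch_apply, Matrix.of_apply]

/-- Within a bucket, the captured energy is a `w`-weighted average of the weights there, hence at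
most any common cap `M j`. -/
lemma orthErr_ge (hw : ∀ i, 0 < w i) {M : Fin m → ℝ} (hM : ∀ j, 0 ≤ M j)
    (hwM : ∀ i ∈ T, w i ≤ M (p i)) :
    ∑ i, w i - ∑ j, M j ≤ orthErr w T p := by
  refine sub_le_sub_left ?_ _
  rw [← Finset.sum_fiberwise T p]
  refine Finset.sum_le_sum fun j _ => ?_
  have h : ∀ i ∈ T.filter (fun i => p i = j), w i ^ 2 / bucketWeight w T p i =
      w i * w i / ∑ l ∈ T with p l = j, w l := by
    intro i hi
    rw [bucketWeight, (Finset.mem_filter.1 hi).2, sq]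
  rw [Finset.sum_congr rfl h, ← Finset.sum_div]
  refine div_le_of_le_mul₀ (Finset.sum_nonneg fun l _ => (hw l).le) (hM j) ?_
  rw [Finset.mul_sum]
  refine Finset.sum_le_sum fun i hi => ?_
  rw [Finset.mem_filter] at hi
  exact mul_le_mul_of_nonneg_right (hi.2 ▸ hwM i hi.1) (hw i).le

lemma orthErr_of_injOn (hw : ∀ i, 0 < w i) (hp : Set.InjOn p T) :
    orthErr w T p = ∑ i, w i - ∑ i ∈ T, w i := by
  rw [orthErr]
  congr 1
  refine Finset.sum_congr rfl fun i hi => ?_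
  have : T.filter (fun l => p l = p i) = {i} := by
    ext l
    simp only [Finset.mem_filter, Finset.mem_singleton]
    exact ⟨fun h => hp h.1 hi h.2, by rintro rfl; exact ⟨hi, rfl⟩⟩
  rw [bucketWeight, this, Finset.sum_singleton]
  have := (hw i).ne'
  field_simp

/-- A row of `K` sharing its bucket with weight `r` from `Kᶜ` loses at most `r`. Each row of `Kᶜ`
meets at most one row of `K`, so it is charged once there and once for its own loss. -/
lemma orthErr_univ_le (hw : ∀ i, 0 < w i) {K : Finset (Fin n)} (hp : Set.InjOn p K) :
    orthErr w Finset.univ p ≤ 2 * ∑ i ∈ Kᶜ, w i := by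
  have hW : ∀ i, 0 < bucketWeight w Finset.univ p i := fun i =>
    (hw i).trans_le (le_bucketWeight hw (Finset.mem_univ i))
  rw [orthErr_eq_sum, ← Finset.sum_add_sum_compl K, two_mul]
  simp only [Finset.mem_univ, if_true]
  refine add_le_add ?_ (Finset.sum_le_sum fun i _ => ?_)
  · calc _ ≤ ∑ i ∈ K, ∑ l ∈ Kᶜ with p l = p i, w l := by
          refine Finset.sum_le_sum fun i hi => ?_
          have hsplit : bucketWeight w Finset.univ p i =
              w i + ∑ l ∈ Kᶜ with p l = p i, w l := by
            rw [bucketWeight, Finset.sum_filter, ← Finset.sum_add_sum_compl K,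
              ← Finset.sum_filter, ← Finset.sum_filter]
            congr 1
            have : K.filter (fun l => p l = p i) = {i} := by
              ext l
              simp only [Finset.mem_filter, Finset.mem_singleton]
              exact ⟨fun h => hp h.1 hi h.2, by rintro rfl; exact ⟨hi, rfl⟩⟩
            rw [this, Finset.sum_singleton]
          have hr : 0 ≤ ∑ l ∈ Kᶜ with p l = p i, w l := Finset.sum_nonneg fun l _ => (hw l).le
          rw [hsplit]
          set r := ∑ l ∈ Kᶜ with p l = p i, w l
          have := hw i
          rw [sub_le_iff_le_add, ← sub_le_iff_le_add', le_div_iff₀ (by linarith)]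
          nlinarith
      _ = ∑ l ∈ Kᶜ, ∑ i ∈ K with p l = p i, w l := by
          simp only [Finset.sum_filter]
          exact Finset.sum_comm
      _ ≤ ∑ l ∈ Kᶜ, w l := by
          refine Finset.sum_le_sum fun l _ => ?_
          rw [Finset.sum_const, nsmul_eq_mul]
          have : (K.filter (fun i => p l = p i)).card ≤ 1 := by
            refine Finset.card_le_one.2 fun a ha b hb => ?_
            rw [Finset.mem_filter] at ha hb
            exact hp ha.1 hb.1 (ha.2.symm.trans hb.2)
          have h1 : ((K.filter (fun i => p l = p i)).card : ℝ) ≤ 1 := by exact_mod_cast this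
          nlinarith [hw l]
  · have := hW i
    have : 0 ≤ w i ^ 2 / bucketWeight w Finset.univ p i := by positivity
    linarith

lemma orthErr_nonneg (hw : ∀ i, 0 < w i) : 0 ≤ orthErr w T p := by
  rw [orthErr_eq_sum]
  refine Finset.sum_nonneg fun i _ => ?_
  split_ifs with hi
  · have h := le_bucketWeight (p := p) hw hi
    have := hw i
    rw [sub_nonneg, div_le_iff₀ (by linarith)]
    nlinarith
  · simpa using (hw i).le

end Weights

lemma countSketch_eq_restrictedSketch {m n : ℕ} (p : Fin n → Fin m) (σ : Fin n → ℤˣ) :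
    countSketch p σ = restrictedSketch Finset.univ p σ := by
  ext j i
  simp [countSketch, restrictedSketch]

/-! ### The first iterations of the greedy algorithm. -/

/-- The columns processed in the first `t` iterations. -/
def processed {n : ℕ} (π : Equiv.Perm (Fin n)) (t : ℕ) : Finset (Fin n) :=
  Finset.univ.filter fun i => (π.symm i : ℕ) < t

section Greedy

variable {m n d : ℕ} {w : Fin n → ℝ} {π : Equiv.Perm (Fin n)} {p : Fin n → Fin m}

lemma mem_processed {t : ℕ} {i : Fin n} : i ∈ processed π t ↔ (π.symm i : ℕ) < t := by
  simp [processed]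

lemma card_processed (t : ℕ) : (processed π t).card = min n t := by
  have : processed π t = (Finset.univ.filter fun i : Fin n => (i : ℕ) < t).map π.toEmbedding := by
    ext i
    simp [processed]
  rw [this, Finset.card_map, Fin.card_filter_val_lt]

lemma partialSketch_add_single (σ : Fin n → ℤˣ) (t : Fin n) (j : Fin m) :
    partialSketch π p σ t + Matrix.single j (π t) ((σ (π t) : ℤ) : ℝ) =
      restrictedSketch (insert (π t) (processed π t)) (Function.update p (π t) j) σ := by
  ext a i
  by_cases hi : i = π t
  · subst hi
    simp [partialSketch, restrictedSketch, Matrix.single_apply]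
  · simp only [partialSketch, restrictedSketch, Matrix.add_apply, Matrix.of_apply,
      Matrix.single_apply, Ne.symm hi, and_false, if_false, add_zero, Finset.mem_insert, hi,
      false_or, mem_processed, Function.update_of_ne (f := p) hi, countSketch]
    split_ifs <;> tauto

/-- By induction on `t`: a collision while some bucket `j` is still empty would contradict the
choice of the minimum, since the gain from `j` exceeds the distortion by `δ`. -/
lemma processed_injOn {N : ℕ} (hN : 0 < N) {δ : ℝ} (hδ : 0 ≤ δ) (hδn : 2 * δ * n < 1)
    (hw : ∀ i, 0 < w i) {Tr : Fin N → Matrix (Fin n) (Fin d) ℝ} (hTr : ∀ a, NearOrth δ w (Tr a))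
    (hπ : Antitone fun t => w (π t)) {σ : Fin n → ℤˣ} (hG : IsGreedy m Tr π p σ) (t : ℕ)
    (ht : t ≤ m) : Set.InjOn p (processed π t) := by
  induction t with
  | zero => intro i hi; simp [processed] at hi
  | succ t ih =>
    have ih := ih (by omega)
    rcases le_or_gt n t with hnt | hnt
    · have : processed π (t + 1) = processed π t := by
        ext i
        simp only [mem_processed]
        omega
      rwa [this]
    set t' : Fin n := ⟨t, hnt⟩
    set T := processed π t with hT
    have hTt : processed π (t + 1) = insert (π t') T := by
      ext i
      rw [Finset.mem_insert, mem_processed, mem_processed, ← Equiv.symm_apply_eq, Fin.ext_iff]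
      simp only [t']
      omega
    have htT : π t' ∉ T := by simp [hT, mem_processed, t']
    rw [hTt, Finset.coe_insert, Set.injOn_insert (by simpa using htT)]
    refine ⟨ih, ?_⟩
    rintro ⟨r, hr, hpr⟩
    obtain ⟨j, hj⟩ : ∃ j, j ∉ T.image p := by
      by_contra! h
      have h1 := Finset.card_le_card (fun j _ => h j : Finset.univ ⊆ T.image p)
      have h2 := (h1.trans Finset.card_image_le).trans_eq (card_processed t)
      simp only [Finset.card_univ, Fintype.card_fin] at h2
      omega
    have hle : ∀ i ∉ T, w i ≤ w (π t') := by
      intro i hi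
      rw [hT, mem_processed, not_lt] at hi
      simpa using hπ (show t' ≤ π.symm i from hi)
    have hge : ∀ i ∈ T, w (π t') ≤ w i := by
      intro i hi
      rw [hT, mem_processed] at hi
      simpa using hπ (show π.symm i ≤ t' from hi.le)
    -- Cap each bucket by its weight from `T`: the new row is no heavier than its bucket mate `r`,
    -- so it respects the cap.
    have hbad : ∑ i, w i - ∑ i ∈ T, w i ≤ orthErr w (insert (π t') T) p := by
      rw [← Finset.sum_fiberwise T p]
      have hsingle : ∀ i ∈ T, w i ≤ ∑ l ∈ T with p l = p i, w l := fun i hi =>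
        le_bucketWeight hw hi
      refine orthErr_ge hw (fun j => Finset.sum_nonneg fun i _ => (hw i).le) fun i hi => ?_
      rcases Finset.mem_insert.1 hi with rfl | hi
      · rw [← hpr]
        exact (hge r hr).trans (hsingle r hr)
      · exact hsingle i hi
    have hgood : orthErr w (insert (π t') T) (Function.update p (π t') j) =
        ∑ i, w i - ∑ i ∈ T, w i - w (π t') := by
      rw [orthErr_of_injOn hw, Finset.sum_insert htT]
      · ring
      · have hne : ∀ i ∈ T, i ≠ π t' := fun i hi h => htT (h ▸ hi)
        rw [Finset.coe_insert, Set.injOn_insert (by simpa using htT)]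
        constructor
        · intro a ha b hb hab
          rw [Function.update_of_ne (hne a ha), Function.update_of_ne (hne b hb)] at hab
          exact ih ha hb hab
        · rintro ⟨a, ha, hab⟩
          rw [Function.update_of_ne (hne a ha), Function.update_self] at hab
          exact hj (Finset.mem_image.2 ⟨a, ha, hab⟩)
    have hP : ∑ i, w i - ∑ i ∈ T, w i ≤ n * w (π t') := by
      rw [← Finset.sum_add_sum_compl T, add_sub_cancel_left]
      calc _ ≤ ∑ i ∈ Tᶜ, w (π t') :=
            Finset.sum_le_sum fun i hi => hle i (Finset.mem_compl.1 hi)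
        _ ≤ _ := by
          rw [Finset.sum_const, nsmul_eq_mul]
          refine mul_le_mul_of_nonneg_right ?_ (hw _).le
          exact_mod_cast (Finset.card_le_univ _).trans_eq (Fintype.card_fin n)
    have hwt := hw (π t')
    have hn : (1 : ℝ) ≤ n := by exact_mod_cast (show 1 ≤ n by omega)
    have hδ1 : δ ≤ 1 := by nlinarith
    have hmain := hG.argmin t' j
    have hself : Function.update p (π t') (p (π t')) = p := Function.update_eq_self _ _
    simp only [partialSketch_add_single, hself] at hmain
    have h1 : ∑ a : Fin N, (1 - δ) * orthErr w (insert (π t') T) p ≤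
        ∑ a : Fin N, (1 + δ) * orthErr w (insert (π t') T) (Function.update p (π t') j) :=
      (Finset.sum_le_sum fun a _ => le_sketchErr hδ1 (hTr a) hw σ m).trans
        (hmain.trans (Finset.sum_le_sum fun a _ => sketchErr_le (hTr a) hw σ))
    simp only [Finset.sum_const, Finset.card_univ, Fintype.card_fin, nsmul_eq_mul] at h1
    have h2 := le_of_mul_le_mul_left h1 (by exact_mod_cast hN)
    rw [hgood] at h2
    -- With `P` the weight outside `T` and `w` that of the new row, `(1 - δ) P ≤ (1 + δ) (P - w)`
    -- gives `(1 + δ) w ≤ 2 δ P ≤ 2 δ n w < w`, a contradiction.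
    have h3 := mul_le_mul_of_nonneg_left hbad (sub_nonneg.2 hδ1)
    have h4 := mul_le_mul_of_nonneg_left hP hδ
    have h5 := mul_lt_mul_of_pos_right hδn hwt
    nlinarith

/-- Were `i` in `L`, all rows up to and including `i` in the order would be in `L`, and these are
more than `m`. -/
lemma notMem_of_notMem_processed (hπ : Antitone fun t => w (π t)) {L : Finset (Fin n)}
    (hL : ∀ i ∈ L, ∀ l ∉ L, w l < w i) (hLm : L.card ≤ m) {i : Fin n}
    (hi : i ∉ processed π m) : i ∉ L := by
  intro hiL
  rw [mem_processed, not_lt] at hi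
  have hsub : processed π (π.symm i + 1) ⊆ L := by
    intro l hl
    rw [mem_processed, Nat.lt_succ_iff] at hl
    by_contra hlL
    have h := hπ (show π.symm l ≤ π.symm i from hl)
    simp only [Equiv.apply_symm_apply] at h
    exact absurd (hL i hiL l hlL) (not_lt.2 h)
  have h := Finset.card_le_card hsub
  rw [card_processed] at h
  have := (π.symm i).isLt
  omega

/-- The margin between 2 and 2.15 absorbs the distortion: `1.01 * 2 ≤ 0.95 * 0.99 * 2.15`. -/
lemma sketchErr_le_expectedRandomErr {δ : ℝ} (hδ : 0 ≤ δ) (hδ1 : δ ≤ 1 / 100)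
    (hw : ∀ i, 0 < w i) {A : Matrix (Fin n) (Fin d) ℝ} (hA : NearOrth δ w A)
    (σ τ : Fin n → ℤˣ) {e : ℝ} (hp : orthErr w Finset.univ p ≤ 2 * e) (he : 0 ≤ e)
    (havg : 2.15 * e * (m : ℝ) ^ n ≤ ∑ q : Fin n → Fin m, orthErr w Finset.univ q) :
    sketchErr m (countSketch p σ) A ≤ (1 - 1 / 20) * expectedRandomErr m m τ A := by
  have h1 : sketchErr m (countSketch p σ) A ≤ (1 + δ) * (2 * e) := by
    rw [countSketch_eq_restrictedSketch]
    exact (sketchErr_le hA hw σ).trans (mul_le_mul_of_nonneg_left hp (by linarith))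
  have hpos : 0 < (m : ℝ) ^ n := by
    have : 0 < Fintype.card (Fin n → Fin m) := Fintype.card_pos_iff.2 ⟨p⟩
    rw [Fintype.card_fun, Fintype.card_fin, Fintype.card_fin] at this
    exact_mod_cast this
  have h2 : (1 - δ) * (2.15 * e) ≤ expectedRandomErr m m τ A := by
    rw [expectedRandomErr, Fintype.card_fun, Fintype.card_fin, Fintype.card_fin, Nat.cast_pow,
      le_div_iff₀ hpos]
    calc (1 - δ) * (2.15 * e) * (m : ℝ) ^ n = (1 - δ) * (2.15 * e * (m : ℝ) ^ n) := by ring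
      _ ≤ (1 - δ) * ∑ q : Fin n → Fin m, orthErr w Finset.univ q :=
        mul_le_mul_of_nonneg_left havg (by linarith)
      _ ≤ _ := by
        rw [Finset.mul_sum]
        refine Finset.sum_le_sum fun q _ => ?_
        rw [countSketch_eq_restrictedSketch]
        exact le_sketchErr (by linarith) hA hw τ m
  nlinarith

end Greedy

/-! ### Expected number of occupied buckets. -/

lemma one_sub_pow_ge {x : ℝ} (hx : 0 ≤ x) (h : ℕ) (hx1 : h * x ≤ 1) :
    1 - h * x + h * (h - 1) / 3 * x ^ 2 ≤ (1 - x) ^ h := by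
  induction h with
  | zero => simp
  | succ h ih =>
    push_cast at hx1 ⊢
    have hh : (0 : ℝ) ≤ h := Nat.cast_nonneg h
    have hhx : 0 ≤ h * x := mul_nonneg hh hx
    have := mul_le_mul_of_nonneg_right (ih (by linarith)) (show 0 ≤ 1 - x by linarith)
    rw [pow_succ (1 - x) h]
    -- The coefficient `1 / 3`, instead of the binomial `1 / 2`, leaves a quadratic surplus that
    -- pays for the cubic term.
    have h2 : 0 ≤ h * x ^ 2 * (1 - (h * x - x)) :=
      mul_nonneg (by positivity) (by linarith)
    linarith

section Occupancy

variable {m n : ℕ}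

lemma card_filter_notMem_image (H : Finset (Fin n)) (j : Fin m) :
    (Finset.univ.filter fun q : Fin n → Fin m => j ∉ H.image q).card =
      (m - 1) ^ H.card * m ^ (n - H.card) := by
  have : (Finset.univ.filter fun q : Fin n → Fin m => j ∉ H.image q) =
      Fintype.piFinset fun i => if i ∈ H then {j}ᶜ else Finset.univ := by
    ext q
    simp only [Finset.mem_filter, Finset.mem_univ, true_and, Finset.mem_image, not_exists, not_and,
      Fintype.mem_piFinset]
    refine forall_congr' fun i => ?_
    by_cases hi : i ∈ H <;> simp [hi]
  rw [this, Fintype.card_piFinset]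
  have h2 : ∀ i, (if i ∈ H then ({j}ᶜ : Finset (Fin m)) else Finset.univ).card =
      if i ∈ H then m - 1 else m := by
    intro i
    split_ifs <;> simp [Finset.card_compl]
  simp only [h2]
  rw [Finset.prod_ite, Finset.prod_const, Finset.prod_const, Finset.filter_univ_mem]
  congr 2
  have := Finset.card_compl H
  rw [Fintype.card_fin] at this
  rw [← this]
  congr 1
  ext i
  simp

/-- Count the missed buckets: a given one is avoided by `H` with probability `(1 - 1 / m) ^ H.card`.
-/
lemma sum_card_image_le (hm : 0 < m) (H : Finset (Fin n)) (hH : H.card ≤ m) :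
    ∑ q : Fin n → Fin m, ((H.image q).card : ℝ) ≤
      (H.card - H.card * (H.card - 1) / (3 * m)) * (m : ℝ) ^ n := by
  have hm' : (0 : ℝ) < m := by exact_mod_cast hm
  have hHn : H.card ≤ n := (Finset.card_le_univ H).trans_eq (Fintype.card_fin n)
  have h1 : ∀ q : Fin n → Fin m, ((H.image q).card : ℝ) =
      ∑ j : Fin m, (1 - if j ∉ H.image q then (1 : ℝ) else 0) := by
    intro q
    rw [Finset.card_eq_sum_ones, Nat.cast_sum, ← Finset.sum_filter_add_sum_filter_not Finset.univ
      (· ∈ H.image q), Finset.filter_univ_mem]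
    have h0 : ∑ j with j ∉ H.image q, (1 - if j ∉ H.image q then (1 : ℝ) else 0) = 0 := by
      refine Finset.sum_eq_zero fun j hj => ?_
      rw [if_pos (Finset.mem_filter.1 hj).2, sub_self]
    rw [h0, add_zero]
    refine Finset.sum_congr rfl fun j hj => ?_
    rw [if_neg (not_not.2 hj)]
    simp
  simp only [h1]
  rw [Finset.sum_comm]
  have h2 : ∀ j : Fin m, ∑ q : Fin n → Fin m, (1 - if j ∉ H.image q then (1 : ℝ) else 0) =
      (m : ℝ) ^ n * (1 - (1 - (m : ℝ)⁻¹) ^ H.card) := by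
    intro j
    rw [Finset.sum_sub_distrib, ← Finset.sum_filter]
    simp only [Finset.sum_const, Finset.card_univ, Fintype.card_fun, Fintype.card_fin,
      card_filter_notMem_image, nsmul_eq_mul, mul_one]
    push_cast [Nat.cast_sub (show 1 ≤ m from hm)]
    have h3 : (m : ℝ) ^ n = (m : ℝ) ^ H.card * (m : ℝ) ^ (n - H.card) := by
      rw [← pow_add, Nat.add_sub_cancel' hHn]
    have h4 : ((m : ℝ) - 1) ^ H.card = (m : ℝ) ^ H.card * (1 - (m : ℝ)⁻¹) ^ H.card := by
      rw [← mul_pow]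
      congr 1
      field_simp
    rw [h4, h3]
    ring
  simp only [h2, Finset.sum_const, Finset.card_univ, Fintype.card_fin, nsmul_eq_mul]
  have h5 := one_sub_pow_ge (x := (m : ℝ)⁻¹) (by positivity) H.card (by
    rw [← div_eq_mul_inv, div_le_one hm']
    exact_mod_cast hH)
  have h6 : (m : ℝ) * (1 - (1 - (m : ℝ)⁻¹) ^ H.card) ≤
      H.card - H.card * (H.card - 1) / (3 * m) := by
    calc _ ≤ (m : ℝ) * (H.card * (m : ℝ)⁻¹ - H.card * (H.card - 1) / 3 * (m : ℝ)⁻¹ ^ 2) :=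
          mul_le_mul_of_nonneg_left (by linarith) hm'.le
      _ = _ := by field_simp
  calc _ = (m : ℝ) * (1 - (1 - (m : ℝ)⁻¹) ^ H.card) * (m : ℝ) ^ n := by ring
    _ ≤ _ := mul_le_mul_of_nonneg_right h6 (by positivity)

end Occupancy

/-! ### Near-orthogonality from inner products, and the comparison shared by both models. -/

lemma nearOrth_of_inner_le {n d : ℕ} {w : Fin n → ℝ} {A : Matrix (Fin n) (Fin d) ℝ} {ε : ℝ}
    (hε : 0 ≤ ε) (hw : ∀ i, 0 ≤ w i) (hnorm : ∀ i, rowNormSq A i = w i)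
    (hinner : ∀ i l, i ≠ l → |∑ j, A i j * A l j| ≤ ε * (√(w i) * √(w l))) :
    NearOrth (n * ε) w A := by
  intro c
  have hexp : ∑ j, (∑ i, c i * A i j) ^ 2 = ∑ i, ∑ l, c i * c l * ∑ j, A i j * A l j := by
    have hsq : ∀ j, (∑ i, c i * A i j) ^ 2 = ∑ i, ∑ l, c i * A i j * (c l * A l j) := fun j => by
      rw [sq, Finset.sum_mul_sum]
    simp only [hsq, Finset.mul_sum]
    rw [Finset.sum_comm]
    refine Finset.sum_congr rfl fun i _ => ?_
    rw [Finset.sum_comm]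
    exact Finset.sum_congr rfl fun l _ => Finset.sum_congr rfl fun j _ => by ring
  have hdiag : ∑ i, w i * c i ^ 2 = ∑ i, ∑ l, if l = i then w i * c i ^ 2 else 0 := by simp
  have hbound : |∑ j, (∑ i, c i * A i j) ^ 2 - ∑ i, w i * c i ^ 2| ≤
      ∑ i, ∑ l, ε * ((|c i| * √(w i)) * (|c l| * √(w l))) := by
    rw [hexp, hdiag, ← Finset.sum_sub_distrib]
    refine (Finset.abs_sum_le_sum_abs _ _).trans (Finset.sum_le_sum fun i _ => ?_)
    rw [← Finset.sum_sub_distrib]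
    refine (Finset.abs_sum_le_sum_abs _ _).trans (Finset.sum_le_sum fun l _ => ?_)
    split_ifs with h
    · subst h
      have : ∑ j, A l j * A l j = w l := by
        rw [← hnorm l]
        exact Finset.sum_congr rfl fun j _ => (sq _).symm
      rw [this, show c l * c l * w l - w l * c l ^ 2 = 0 by ring, abs_zero]
      positivity
    · rw [sub_zero, abs_mul, abs_mul]
      calc _ ≤ |c i| * |c l| * (ε * (√(w i) * √(w l))) :=
            mul_le_mul_of_nonneg_left (hinner i l (Ne.symm h)) (by positivity)
        _ = _ := by ring
  -- The double sum is a square; Cauchy–Schwarz costs the factor `n`.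
  have hcs : ∑ i, ∑ l, ε * ((|c i| * √(w i)) * (|c l| * √(w l))) ≤
      n * ε * ∑ i, w i * c i ^ 2 := by
    simp only [← Finset.mul_sum]
    rw [← Finset.sum_mul, ← sq]
    have h := sq_sum_le_card_mul_sum_sq (s := (Finset.univ : Finset (Fin n)))
      (f := fun i => |c i| * √(w i))
    have h2 : ∀ i, (|c i| * √(w i)) ^ 2 = w i * c i ^ 2 := fun i => by
      rw [mul_pow, sq_abs, Real.sq_sqrt (hw i), mul_comm]
    simp only [h2, Finset.card_univ, Fintype.card_fin] at h
    nlinarith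
  have := abs_le.1 (hbound.trans hcs)
  constructor <;> linarith

lemma greedy_le_expectedRandomErr {m n d N : ℕ} (hN : 0 < N) {δ : ℝ} (hδ : 0 ≤ δ)
    (hδ1 : δ ≤ 1 / 100) (hδn : 2 * δ * n < 1) {w : Fin n → ℝ} (hw : ∀ i, 0 < w i)
    {Tr : Fin N → Matrix (Fin n) (Fin d) ℝ} {A : Matrix (Fin n) (Fin d) ℝ}
    (hTr : ∀ a, NearOrth δ w (Tr a)) (hA : NearOrth δ w A)
    {π : Equiv.Perm (Fin n)} {p : Fin n → Fin m} {σ : Fin n → ℤˣ} (τ : Fin n → ℤˣ)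
    (hπ : Antitone fun t => w (π t)) (hG : IsGreedy m Tr π p σ)
    (h : m < n → ∃ e, 0 ≤ e ∧ ∑ i ∈ (processed π m)ᶜ, w i ≤ e ∧
      2.15 * e * (m : ℝ) ^ n ≤ ∑ q : Fin n → Fin m, orthErr w Finset.univ q) :
    sketchErr m (countSketch p σ) A ≤ (1 - 1 / 20) * expectedRandomErr m m τ A := by
  have hp := orthErr_univ_le hw (processed_injOn hN hδ hδn hw hTr hπ hG m le_rfl)
  rcases lt_or_ge m n with hmn | hmn
  · obtain ⟨e, he, hle, havg⟩ := h hmn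
    exact sketchErr_le_expectedRandomErr hδ hδ1 hw hA σ τ (hp.trans (by linarith)) he havg
  -- All rows fit into distinct buckets, so `orthErr` vanishes and `e = 0` serves.
  · have hK : (processed π m)ᶜ = ∅ := by
      ext i
      simp only [Finset.mem_compl, mem_processed, Finset.notMem_empty, iff_false, not_not]
      exact (π.symm i).isLt.trans_le hmn
    rw [hK, Finset.sum_empty] at hp
    refine sketchErr_le_expectedRandomErr hδ hδ1 hw hA σ τ hp le_rfl ?_
    simpa using Finset.sum_nonneg fun q _ => orthErr_nonneg hw

/-! ### The spiked covariance model: the deterministic part -/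

/-- Cap a bucket by `L` if a spike falls into it and by `1` otherwise; only the number of buckets
hit by spikes is random. -/
lemma spiked_sum_orthErr_ge {n k : ℕ} (hk : 0 < k) {L : ℝ} (hL : 1 ≤ L) (R : Finset (Fin n))
    (hR : R.card ≤ k) :
    ((n : ℝ) - k + (L - 1) * (R.card * (R.card - 1) / (3 * k))) * (k : ℝ) ^ n ≤
      ∑ q : Fin n → Fin k, orthErr (fun i => if i ∈ R then L else 1) Finset.univ q := by
  have hq : ∀ q : Fin n → Fin k, (n : ℝ) - k + (L - 1) * (R.card - (R.image q).card) ≤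
      orthErr (fun i => if i ∈ R then L else 1) Finset.univ q := by
    intro q
    refine le_trans (le_of_eq ?_) (orthErr_ge (M := fun j => if j ∈ R.image q then L else 1)
      (fun i => ?_) (fun j => ?_) (fun i _ => ?_))
    · have hs : ∀ (N : ℕ) (S : Finset (Fin N)), ∑ i, (if i ∈ S then L else 1) =
          N + (L - 1) * S.card := by
        intro N S
        have : ∀ i, (if i ∈ S then L else 1) = 1 + if i ∈ S then L - 1 else 0 := by
          intro i
          split_ifs <;> ring
        simp only [this, Finset.sum_add_distrib, Finset.sum_ite_mem, Finset.univ_inter,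
          Finset.sum_const, Finset.card_univ, Fintype.card_fin, nsmul_eq_mul]
        ring
      rw [hs, hs]
      ring
    · show 0 < if i ∈ R then L else 1
      split_ifs <;> linarith
    · show 0 ≤ if j ∈ R.image q then L else 1
      split_ifs <;> linarith
    · show (if i ∈ R then L else 1) ≤ if q i ∈ R.image q then L else 1
      by_cases hi : i ∈ R
      · rw [if_pos hi, if_pos (Finset.mem_image_of_mem q hi)]
      · rw [if_neg hi]
        split_ifs <;> linarith
  refine le_trans ?_ (Finset.sum_le_sum fun q _ => hq q)
  simp only [Finset.sum_add_distrib, ← Finset.mul_sum, Finset.sum_sub_distrib, Finset.sum_const,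
    Finset.card_univ, Fintype.card_fun, Fintype.card_fin, nsmul_eq_mul]
  have h := mul_le_mul_of_nonneg_left (sum_card_image_le hk R hR) (sub_nonneg.2 hL)
  push_cast
  linarith

lemma spike_count_bound {k s : ℕ} (hk : 2 ≤ k) (h1 : 0.7 * ((k : ℝ) - 1) < s)
    (h2 : (s : ℝ) < k - 1) : 0.32 * (k : ℝ) ^ 2 ≤ ((s : ℝ) - 1) * (k - 1) := by
  have h1' : 7 * k < 10 * s + 7 := by
    have : (7 : ℝ) * k < 10 * s + 7 := by linarith
    exact_mod_cast this
  have h2' : s + 1 < k := by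
    have : (s : ℝ) + 1 < k := by linarith
    exact_mod_cast this
  rcases le_or_gt 6 k with h6 | h6
  · have : (6 : ℝ) ≤ k := by exact_mod_cast h6
    nlinarith
  -- The only integer pair with `k < 6`; here the constant `0.32` is attained.
  · obtain ⟨rfl, rfl⟩ : k = 5 ∧ s = 3 := by omega
    norm_num

lemma spike_energy_bound {n k s : ℕ} {ℓ α : ℝ} (hk : 2 ≤ k) (hα : 0.7 < α) (hα1 : α < 1)
    (hs : (s : ℝ) = α * ((k : ℝ) - 1)) (hkn : k < n)
    (hℓ : (4 * Real.exp 1 + 1) * (n : ℝ) / (α * (k : ℝ)) ≤ ℓ ^ 2) :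
    1.15 * (n : ℝ) ≤ (ℓ ^ 2 - 1) * (s * (s - 1) / (3 * k)) := by
  have hk' : (2 : ℝ) ≤ k := by exact_mod_cast hk
  have hkn' : (k : ℝ) < n := by exact_mod_cast hkn
  have hαk : 0 < α * k := by positivity
  have hcount := spike_count_bound hk (by rw [hs]; nlinarith) (by rw [hs]; nlinarith)
  rw [div_le_iff₀ hαk] at hℓ
  have he := Real.exp_one_gt_d9
  -- `4 e + 1 > 11.87`; passing to `ℓ ^ 2 - 1` costs `α k < n`; finally `10.87 * 0.32 / 3 > 1.15`.
  have h1 : 11.87 * (n : ℝ) ≤ ℓ ^ 2 * (α * k) := by nlinarith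
  have h2 : 10.87 * (n : ℝ) ≤ (ℓ ^ 2 - 1) * (α * k) := by nlinarith
  have h3 : 10.87 * n * (0.32 * (k : ℝ) ^ 2) ≤
      (ℓ ^ 2 - 1) * (α * k) * (((s : ℝ) - 1) * (k - 1)) :=
    mul_le_mul h2 hcount (by positivity) (by nlinarith)
  have h4 : (ℓ ^ 2 - 1) * (α * k) * (((s : ℝ) - 1) * (k - 1)) =
      (ℓ ^ 2 - 1) * (s * (s - 1)) * k := by
    rw [hs]
    ring
  rw [h4] at h3
  have h5 : 10.87 * n * (0.32 * (k : ℝ)) ≤ (ℓ ^ 2 - 1) * (s * (s - 1)) := by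
    refine le_of_mul_le_mul_right ?_ (show (0 : ℝ) < k by linarith)
    linarith
  rw [← mul_div_assoc, le_div_iff₀ (by linarith)]
  nlinarith [mul_nonneg (show (0 : ℝ) ≤ n by linarith) (show (0 : ℝ) ≤ k by linarith)]

lemma spiked_greedy_le {n d k s N : ℕ} {ℓ α : ℝ} (hk : 2 ≤ k) (hα : 0.7 < α) (hα1 : α < 1)
    (hs : (s : ℝ) = α * ((k : ℝ) - 1)) (hℓ1 : 1 < ℓ)
    (hℓ : (4 * Real.exp 1 + 1) * (n : ℝ) / (α * (k : ℝ)) ≤ ℓ ^ 2)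
    {R : Finset (Fin n)} (hR : R.card = s) (hN : 0 < N) {δ : ℝ} (hδ : 0 ≤ δ)
    (hδ1 : δ ≤ 1 / 100) (hδn : 2 * δ * n < 1)
    {Tr : Fin N → Matrix (Fin n) (Fin d) ℝ} {A : Matrix (Fin n) (Fin d) ℝ}
    (hTr : ∀ a, NearOrth δ (fun i => if i ∈ R then ℓ ^ 2 else 1) (Tr a))
    (hA : NearOrth δ (fun i => if i ∈ R then ℓ ^ 2 else 1) A)
    (hnorm : ∀ a i, rowNormSq (Tr a) i = if i ∈ R then ℓ ^ 2 else 1)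
    {π : Equiv.Perm (Fin n)} {p : Fin n → Fin k} {σ : Fin n → ℤˣ} (τ : Fin n → ℤˣ)
    (hG : IsGreedy k Tr π p σ) :
    sketchErr k (countSketch p σ) A ≤ (1 - 1 / 20) * expectedRandomErr k k τ A := by
  have hL : 1 < ℓ ^ 2 := by nlinarith
  have hk' : (2 : ℝ) ≤ k := by exact_mod_cast hk
  have hsk : s ≤ k := by
    have : (s : ℝ) ≤ k := by rw [hs]; nlinarith
    exact_mod_cast this
  have hπ : Antitone fun t => (fun i => if i ∈ R then ℓ ^ 2 else 1) (π t) := by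
    have := hG.order ⟨0, hN⟩
    simpa only [hnorm] using this
  refine greedy_le_expectedRandomErr hN hδ hδ1 hδn (fun i => ?_) hTr hA τ hπ hG fun hkn => ?_
  · show 0 < if i ∈ R then ℓ ^ 2 else 1
    split_ifs <;> linarith
  have hkn' : (k : ℝ) < n := by exact_mod_cast hkn
  refine ⟨n - k, by linarith, le_of_eq ?_, ?_⟩
  · have h1 : ∀ i ∈ (processed π k)ᶜ, (if i ∈ R then ℓ ^ 2 else 1) = (1 : ℝ) := by
      intro i hi
      refine if_neg (notMem_of_notMem_processed
        (w := fun i => if i ∈ R then ℓ ^ 2 else 1) hπ (fun a ha b hb => ?_) (hR.trans_le hsk)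
        (Finset.mem_compl.1 hi))
      simpa [ha, hb] using hL
    rw [Finset.sum_congr rfl h1, Finset.sum_const, Finset.card_compl, card_processed,
      Fintype.card_fin, min_eq_right hkn.le, nsmul_eq_mul, mul_one, Nat.cast_sub hkn.le]
  · refine le_trans ?_ (spiked_sum_orthErr_ge (by omega) hL.le R (hR.trans_le hsk))
    refine mul_le_mul_of_nonneg_right ?_ (by positivity)
    have := spike_energy_bound hk hα hα1 hs hkn hℓ
    rw [hR]
    linarith

/-! ### The Zipfian model -/

lemma sum_range_sub_of_le (u : ℕ → ℝ) {a b : ℕ} (hab : a ≤ b) :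
    ∑ t ∈ Finset.range b, (if a ≤ t then u t - u (t + 1) else 0) = u a - u b := by
  induction b, hab using Nat.le_induction with
  | base =>
    rw [sub_self]
    refine Finset.sum_eq_zero fun t ht => if_neg ?_
    have := Finset.mem_range.1 ht
    omega
  | succ b hab ih =>
    rw [Finset.sum_range_succ, ih, if_pos hab]
    ring

lemma sum_Ico_div_two_pow (x : ℝ) {a b : ℕ} (hab : a ≤ b) :
    ∑ t ∈ Finset.Ico (a + 1) (b + 1), x / 2 ^ t = x / 2 ^ a - x / 2 ^ b := by
  induction b, hab using Nat.le_induction with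
  | base => simp
  | succ b hab ih =>
    rw [Finset.sum_Ico_succ_top (by omega), ih, pow_succ]
    ring

section Zipf

variable {n h : ℕ} {c : Fin n → ℕ}

lemma IsZipfProfile.card_le_class (hc : IsZipfProfile h c) {t : ℕ} (ht : t ≤ h) :
    (Finset.univ.filter fun r => c r ≤ t).card + 4 = 2 ^ (t + 2) := by
  induction t with
  | zero =>
    have : (Finset.univ.filter fun r => c r ≤ 0) = ∅ := by
      refine Finset.filter_eq_empty_iff.2 fun r _ => ?_
      have := (Finset.mem_Icc.1 (hc.1 r)).1
      omega
    rw [this]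
    rfl
  | succ t ih =>
    have hu : (Finset.univ.filter fun r => c r ≤ t + 1) =
        (Finset.univ.filter fun r => c r ≤ t) ∪ Finset.univ.filter fun r => c r = t + 1 := by
      ext r
      simp only [Finset.mem_filter, Finset.mem_univ, true_and, Finset.mem_union]
      omega
    have hd : Disjoint (Finset.univ.filter fun r => c r ≤ t)
        (Finset.univ.filter fun r => c r = t + 1) := by
      refine Finset.disjoint_filter.2 fun r _ h1 h2 => ?_
      omega
    rw [hu, Finset.card_union_of_disjoint hd, hc.2 (t + 1) (Finset.mem_Icc.2 ⟨by omega, ht⟩)]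
    have := ih (by omega)
    rw [show t + 1 + 2 = (t + 2) + 1 by ring, pow_succ 2 (t + 2), show t + 1 + 1 = t + 2 by ring]
    omega

lemma zipf_sum_orthErr_ge {k I : ℕ} (hk : 0 < k) (hkn : k ≤ n) (hc : IsZipfProfile h c)
    (hI : I ≤ h) (hIk : 2 ^ (I + 2) ≤ k + 4) {V : ℝ} (hV : 0 < V) :
    ((I : ℝ) - 1) * (V / k) * (k : ℝ) ^ n ≤
      ∑ q : Fin n → Fin k, orthErr (fun r => V / 2 ^ (2 * c r)) Finset.univ q := by
  set u : ℕ → ℝ := fun t => V / 2 ^ (2 * t) with hu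
  set H : ℕ → Finset (Fin n) := fun t => Finset.univ.filter fun r => c r ≤ t with hH
  have hg : ∀ t, u t - u (t + 1) = 3 / 4 * u t := by
    intro t
    simp only [hu, mul_add, pow_add]
    ring
  have hupos : ∀ t, 0 < u t := fun t => by positivity
  have hg0 : ∀ t, 0 ≤ u t - u (t + 1) := fun t => by
    rw [hg]
    linarith [hupos t]
  -- Layer-cake decomposition of the weights; the bucket caps below use the same layers, so each
  -- level set `H t` reduces to an occupancy count.
  have hwr : ∀ r, u (c r) = u (h + 1) +
      ∑ t ∈ Finset.range (h + 1), (if c r ≤ t then u t - u (t + 1) else 0) := by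
    intro r
    rw [sum_range_sub_of_le u ((Finset.mem_Icc.1 (hc.1 r)).2.trans (Nat.le_succ h)), add_sub_cancel]
  have hnk : (0 : ℝ) ≤ (n : ℝ) - k := by
    rw [sub_nonneg]
    exact_mod_cast hkn
  have hq : ∀ q : Fin n → Fin k,
      ∑ t ∈ Finset.range (h + 1), (u t - u (t + 1)) * ((H t).card - ((H t).image q).card) ≤
        orthErr (fun r => u (c r)) Finset.univ q := by
    intro q
    refine le_trans ?_ (orthErr_ge (fun r => hupos (c r))
      (M := fun j => u (h + 1) +
        ∑ t ∈ Finset.range (h + 1), (if j ∈ (H t).image q then u t - u (t + 1) else 0))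
      (fun j => ?_) fun i _ => ?_)
    · simp only [hwr]
      rw [Finset.sum_add_distrib, Finset.sum_add_distrib, Finset.sum_comm,
        Finset.sum_comm (s := (Finset.univ : Finset (Fin k)))]
      have h1 : ∀ t, ∑ r, (if c r ≤ t then u t - u (t + 1) else 0) =
          (u t - u (t + 1)) * (H t).card := by
        intro t
        rw [← Finset.sum_filter, Finset.sum_const, nsmul_eq_mul, mul_comm]
      have h2 : ∀ t, ∑ j, (if j ∈ (H t).image q then u t - u (t + 1) else 0) =
          (u t - u (t + 1)) * ((H t).image q).card := by
        intro t
        rw [Finset.sum_ite_mem, Finset.univ_inter, Finset.sum_const, nsmul_eq_mul, mul_comm]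
      simp only [h1, h2, mul_sub, Finset.sum_sub_distrib, Finset.sum_const, Finset.card_univ,
        Fintype.card_fin, nsmul_eq_mul]
      linarith [mul_nonneg hnk (hupos (h + 1)).le]
    · refine add_nonneg (hupos _).le (Finset.sum_nonneg fun t _ => ?_)
      split_ifs
      exacts [hg0 t, le_rfl]
    · rw [hwr i]
      refine add_le_add_right (Finset.sum_le_sum fun t _ => ?_) _
      by_cases hi : c i ≤ t
      · rw [if_pos hi, if_pos (Finset.mem_image_of_mem q (by simpa [hH] using hi))]
      · rw [if_neg hi]
        split_ifs
        exacts [hg0 t, le_rfl]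
  refine le_trans ?_ (Finset.sum_le_sum fun q _ => hq q)
  rw [Finset.sum_comm]
  have hk' : (0 : ℝ) < k := by exact_mod_cast hk
  have hnn : ∀ t, 0 ≤ ∑ q : Fin n → Fin k,
      (u t - u (t + 1)) * (((H t).card : ℝ) - ((H t).image q).card) := by
    refine fun t => Finset.sum_nonneg fun q _ => mul_nonneg (hg0 t) (sub_nonneg.2 ?_)
    exact_mod_cast Finset.card_image_le
  -- The collisions grow like `(H t).card ^ 2`, which cancels the decay `4 ^ (-t)` of the weights.
  -- From `t = 2` on, `x = 2 ^ t` satisfies `(4 x - 4) (4 x - 5) ≥ 4 x ^ 2`.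
  have hterm : ∀ t ∈ Finset.Ico 2 (I + 1), V / k * (k : ℝ) ^ n ≤ ∑ q : Fin n → Fin k,
      (u t - u (t + 1)) * (((H t).card : ℝ) - ((H t).image q).card) := by
    intro t ht
    rw [Finset.mem_Ico] at ht
    have hcard := hc.card_le_class (t := t) (by omega)
    have hmono : 2 ^ (t + 2) ≤ 2 ^ (I + 2) := Nat.pow_le_pow_right (by norm_num) (by omega)
    have hHk : (H t).card ≤ k := by
      simp only [hH]
      omega
    have hHcard : ((H t).card : ℝ) = 4 * 2 ^ t - 4 := by
      have : ((H t).card : ℝ) + 4 = 2 ^ (t + 2) := by exact_mod_cast hcard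
      rw [pow_add] at this
      linarith
    have hx : (4 : ℝ) ≤ 2 ^ t := by
      calc (4 : ℝ) = 2 ^ 2 := by norm_num
        _ ≤ 2 ^ t := pow_le_pow_right₀ (by norm_num) ht.1
    have hexc := sum_card_image_le hk (H t) hHk
    rw [← Finset.mul_sum, Finset.sum_sub_distrib]
    simp only [Finset.sum_const, Finset.card_univ, Fintype.card_fun, Fintype.card_fin,
      nsmul_eq_mul]
    push_cast
    have h1 : V / k * (k : ℝ) ^ n ≤ (u t - u (t + 1)) *
        ((H t).card * ((H t).card - 1) / (3 * k) * (k : ℝ) ^ n) := by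
      rw [← mul_assoc]
      refine mul_le_mul_of_nonneg_right ?_ (by positivity)
      rw [hg, hHcard]
      simp only [hu]
      rw [show 2 * t = t * 2 by ring, pow_mul, ← sub_nonneg]
      set x : ℝ := 2 ^ t
      have : 3 / 4 * (V / x ^ 2) * ((4 * x - 4) * (4 * x - 4 - 1) / (3 * k)) - V / k =
          V / (4 * x ^ 2 * k) * ((4 * x - 4) * (4 * x - 4 - 1) - 4 * x ^ 2) := by
        field_simp
      rw [this]
      have h2 : 0 ≤ (4 * x - 4) * (4 * x - 4 - 1) - 4 * x ^ 2 := by nlinarith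
      positivity
    refine h1.trans (mul_le_mul_of_nonneg_left ?_ (hg0 t))
    linarith
  calc ((I : ℝ) - 1) * (V / k) * (k : ℝ) ^ n
      ≤ ∑ t ∈ Finset.Ico 2 (I + 1), V / k * (k : ℝ) ^ n := by
        rw [Finset.sum_const, Nat.card_Ico, nsmul_eq_mul, mul_assoc]
        refine mul_le_mul_of_nonneg_right ?_ (by positivity)
        have : (I : ℝ) ≤ (I + 1 - 2 : ℕ) + 1 := by exact_mod_cast (by omega)
        linarith
    _ ≤ _ := Finset.sum_le_sum hterm
    _ ≤ _ := Finset.sum_le_sum_of_subset_of_nonneg (fun t ht => by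
        rw [Finset.mem_Ico] at ht
        rw [Finset.mem_range]
        omega) fun t _ _ => hnn t

/-- Class `t` has total weight `2 V / 2 ^ t`, so the tail is a geometric sum. -/
lemma zipf_sum_tail_le (hc : IsZipfProfile h c) {I : ℕ} (hI : I ≤ h) {V : ℝ} (hV : 0 ≤ V)
    (S : Finset (Fin n)) (hS : ∀ r ∈ S, I < c r) :
    ∑ r ∈ S, V / 2 ^ (2 * c r) ≤ 2 * V / 2 ^ I := by
  have hmaps : ∀ r ∈ S, c r ∈ Finset.Ico (I + 1) (h + 1) := by
    intro r hr
    have h1 := (Finset.mem_Icc.1 (hc.1 r)).2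
    have h2 := hS r hr
    rw [Finset.mem_Ico]
    omega
  rw [← Finset.sum_fiberwise_of_maps_to hmaps]
  calc _ ≤ ∑ t ∈ Finset.Ico (I + 1) (h + 1), 2 * V / 2 ^ t := by
        refine Finset.sum_le_sum fun t ht => ?_
        rw [Finset.mem_Ico] at ht
        have hcard := hc.2 t (Finset.mem_Icc.2 ⟨by omega, by omega⟩)
        calc ∑ r ∈ S with c r = t, V / 2 ^ (2 * c r)
            = ∑ r ∈ S with c r = t, V / 2 ^ (2 * t) :=
              Finset.sum_congr rfl fun r hr => by rw [(Finset.mem_filter.1 hr).2]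
          _ ≤ ∑ r with c r = t, V / 2 ^ (2 * t) :=
              Finset.sum_le_sum_of_subset_of_nonneg
                (Finset.filter_subset_filter _ (Finset.subset_univ S)) fun _ _ _ => by positivity
          _ = 2 * V / 2 ^ t := by
              rw [Finset.sum_const, hcard, nsmul_eq_mul, two_mul t, pow_add (2 : ℝ) t t]
              push_cast
              field_simp
              ring
    _ = 2 * V / 2 ^ I - 2 * V / 2 ^ h := sum_Ico_div_two_pow (2 * V) hI
    _ ≤ _ := by
        have : 0 ≤ 2 * V / 2 ^ h := by positivity
        linarith

lemma IsZipf.nearOrth {d : ℕ} {A : Matrix (Fin n) (Fin d) ℝ} (hA : IsZipf c A) :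
    NearOrth 0 (fun r => (n : ℝ) ^ 2 / 2 ^ (2 * c r)) A := by
  have := nearOrth_of_inner_le (w := fun r => (n : ℝ) ^ 2 / 2 ^ (2 * c r)) le_rfl
    (fun r => by positivity) hA.norm_sq fun i l hil => by
      rw [hA.orthogonal i l hil, abs_zero, zero_mul]
  rwa [mul_zero] at this

lemma zipf_greedy_le {d k N : ℕ} (hk : 2 ^ 50 ≤ k) (hc : IsZipfProfile h c) (hN : 0 < N)
    {Tr : Fin N → Matrix (Fin n) (Fin d) ℝ} {A : Matrix (Fin n) (Fin d) ℝ}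
    (hTr : ∀ a, IsZipf c (Tr a)) (hA : IsZipf c A)
    {π : Equiv.Perm (Fin n)} {p : Fin n → Fin k} {σ : Fin n → ℤˣ} (τ : Fin n → ℤˣ)
    (hG : IsGreedy k Tr π p σ) :
    sketchErr k (countSketch p σ) A ≤ (1 - 1 / 20) * expectedRandomErr k k τ A := by
  have hπ : Antitone fun t => (fun r => (n : ℝ) ^ 2 / 2 ^ (2 * c r)) (π t) := by
    have := hG.order ⟨0, hN⟩
    simpa only [(hTr _).norm_sq] using this
  refine greedy_le_expectedRandomErr hN le_rfl (by norm_num) (by norm_num) (fun r => ?_)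
    (fun a => (hTr a).nearOrth) hA.nearOrth τ hπ hG fun hkn => ?_
  · have : 0 < n := r.pos
    positivity
  have hk0 : 0 < k := lt_of_lt_of_le (by norm_num) hk
  have hk' : (0 : ℝ) < k := by exact_mod_cast hk0
  have hn : (0 : ℝ) < n := by exact_mod_cast hk0.trans hkn
  -- Classes `1, …, I` have `2 ^ (I + 2) - 4` rows together, so this is the largest `I` for which
  -- that number is at most `k`.
  obtain ⟨I, hI⟩ : ∃ I, Nat.log 2 (k + 4) = I + 2 := by
    have : 50 ≤ Nat.log 2 (k + 4) := Nat.le_log_of_pow_le (by norm_num) (by omega)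
    exact ⟨Nat.log 2 (k + 4) - 2, by omega⟩
  have hI48 : 48 ≤ I := by
    have : 50 ≤ Nat.log 2 (k + 4) := Nat.le_log_of_pow_le (by norm_num) (by omega)
    omega
  have hlow : 2 ^ (I + 2) ≤ k + 4 := hI ▸ Nat.pow_log_le_self 2 (by omega)
  have hupp : k + 4 < 2 ^ (I + 3) := by
    have := Nat.lt_pow_succ_log_self (b := 2) (by norm_num) (k + 4)
    rwa [hI] at this
  have hIh : I ≤ h := by
    have huniv := hc.card_le_class le_rfl
    rw [Finset.filter_true_of_mem fun r _ => (Finset.mem_Icc.1 (hc.1 r)).2, Finset.card_univ,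
      Fintype.card_fin] at huniv
    have : 2 ^ (I + 2) < 2 ^ (h + 2) := by omega
    have := (Nat.pow_lt_pow_iff_right (by norm_num)).1 this
    omega
  -- The tail `2 n ^ 2 / 2 ^ I` is at most this as `k < 2 ^ (I + 3)`; and `2.15 * 16 ≤ 47 ≤ I - 1`.
  refine ⟨16 * (n : ℝ) ^ 2 / k, by positivity, ?_, ?_⟩
  · refine (zipf_sum_tail_le hc hIh (by positivity) _ fun r hr => ?_).trans ?_
    · have := notMem_of_notMem_processed (w := fun r => (n : ℝ) ^ 2 / 2 ^ (2 * c r))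
        (L := Finset.univ.filter fun r => c r ≤ I) hπ
        (fun a ha b hb => ?_) ?_ (Finset.mem_compl.1 hr)
      · simpa using this
      · simp only [Finset.mem_filter, Finset.mem_univ, true_and, not_le] at ha hb
        have h1 : (2 : ℝ) ^ (2 * c a) < 2 ^ (2 * c b) :=
          pow_lt_pow_right₀ (by norm_num) (by omega)
        exact div_lt_div_of_pos_left (by positivity) (by positivity) h1
      · have := hc.card_le_class hIh
        omega
    · have h1 : (k : ℝ) ≤ 2 ^ (I + 3) := by exact_mod_cast (by omega : k ≤ 2 ^ (I + 3))
      rw [pow_add] at h1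
      rw [div_le_div_iff₀ (by positivity) hk']
      nlinarith [sq_nonneg (n : ℝ)]
  · refine le_trans ?_ (zipf_sum_orthErr_ge hk0 hkn.le hc hIh hlow (by positivity))
    refine mul_le_mul_of_nonneg_right ?_ (by positivity)
    have : (48 : ℝ) ≤ I := by exact_mod_cast hI48
    rw [mul_div_assoc, ← mul_assoc]
    exact mul_le_mul_of_nonneg_right (by linarith) (by positivity)

end Zipf

/-! ### Near-orthogonality of random unit vectors -/

section Sphere

variable {d : ℕ}

local notation "𝕊" d => Metric.sphere (0 : EuclideanSpace ℝ (Fin d)) 1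

lemma isProbabilityMeasure_uniformSphere (hd : 0 < d) : IsProbabilityMeasure (uniformSphere d) := by
  have : Nonempty (Fin d) := ⟨⟨0, hd⟩⟩
  refine ⟨?_⟩
  rw [uniformSphere, Measure.smul_apply, smul_eq_mul]
  refine ENNReal.inv_mul_cancel ?_ (measure_ne_top _ _)
  simp [hd.ne', (Metric.measure_ball_pos volume (0 : EuclideanSpace ℝ (Fin d)) one_pos).ne']

open scoped Pointwise in
-- The cone over the cap lies in a ball about `ε • e` of squared radius `1 - ε ^ 2 ≤ exp (-ε ^ 2)`;
-- comparing volumes with the unit ball gives the bound.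
lemma uniformSphere_cap_le (hd : 0 < d) {e : EuclideanSpace ℝ (Fin d)} (he : ‖e‖ = 1) {ε : ℝ}
    (hε : 0 < ε) (hε1 : ε ^ 2 ≤ 1 / 2) :
    uniformSphere d {u : 𝕊 d | ε < inner ℝ (u : EuclideanSpace ℝ (Fin d)) e} ≤
      ENNReal.ofReal (Real.exp (-(ε ^ 2 / 2)) ^ d) := by
  have : Nonempty (Fin d) := ⟨⟨0, hd⟩⟩
  set ρ := Real.exp (-(ε ^ 2 / 2)) with hρ
  set s : Set (𝕊 d) := {u | ε < inner ℝ (u : EuclideanSpace ℝ (Fin d)) e} with hs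
  have hsm : MeasurableSet s := by
    refine (isOpen_lt continuous_const ?_).measurableSet
    fun_prop
  have hρ2 : 1 - ε ^ 2 ≤ ρ ^ 2 := by
    rw [hρ, ← Real.exp_nat_mul]
    have := Real.add_one_le_exp (-(ε ^ 2))
    have h2 : ((2 : ℕ) : ℝ) * -(ε ^ 2 / 2) = -(ε ^ 2) := by
      push_cast
      ring
    rw [h2]
    linarith
  have hsub : Set.Ioo (0 : ℝ) 1 • (((↑) : (𝕊 d) → EuclideanSpace ℝ (Fin d)) '' s) ⊆
      Metric.ball (ε • e) ρ := by
    rintro _ ⟨r, ⟨hr0, hr1⟩, _, ⟨u, hu, rfl⟩, rfl⟩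
    rw [mem_ball_iff_norm]
    refine lt_of_pow_lt_pow_left₀ 2 (Real.exp_pos _).le (lt_of_lt_of_le ?_ hρ2)
    have hu1 : ‖(u : EuclideanSpace ℝ (Fin d))‖ = 1 := by simp
    have hu' : ε < inner ℝ (u : EuclideanSpace ℝ (Fin d)) e := hu
    show ‖r • (u : EuclideanSpace ℝ (Fin d)) - ε • e‖ ^ 2 < 1 - ε ^ 2
    rw [norm_sub_sq_real, norm_smul, norm_smul, hu1, he, real_inner_smul_left,
      real_inner_smul_right, Real.norm_eq_abs, Real.norm_eq_abs, mul_one, mul_one, sq_abs, sq_abs]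
    -- What remains is `(r - 1) (r + 1 - 2 ε ^ 2) ≤ 0`, where `ε ^ 2 ≤ 1 / 2` enters.
    have h1 := mul_lt_mul_of_pos_left hu' (mul_pos hr0 hε)
    nlinarith
  have hcap : (volume : Measure (EuclideanSpace ℝ (Fin d))).toSphere s ≤
      ENNReal.ofReal (ρ ^ d) * (volume : Measure (EuclideanSpace ℝ (Fin d))).toSphere Set.univ := by
    rw [Measure.toSphere_apply' _ hsm, Measure.toSphere_apply_univ]
    calc _ ≤ (Module.finrank ℝ (EuclideanSpace ℝ (Fin d)) : ENNReal) *
          volume (Metric.ball (ε • e) ρ) := by gcongr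
      _ = _ := by
        rw [Measure.addHaar_ball_of_pos _ _ (Real.exp_pos _), finrank_euclideanSpace_fin]
        ring
  rw [uniformSphere, Measure.smul_apply, smul_eq_mul, mul_comm, ← div_eq_mul_inv]
  exact ENNReal.div_le_of_le_mul hcap

lemma uniformSphere_abs_inner_le (hd : 0 < d) {e : EuclideanSpace ℝ (Fin d)} (he : ‖e‖ = 1)
    {ε : ℝ} (hε : 0 < ε) (hε1 : ε ^ 2 ≤ 1 / 2) :
    uniformSphere d {u : 𝕊 d | ε < |inner ℝ (u : EuclideanSpace ℝ (Fin d)) e|} ≤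
      2 * ENNReal.ofReal (Real.exp (-(ε ^ 2 / 2)) ^ d) := by
  have hsub : {u : 𝕊 d | ε < |inner ℝ (u : EuclideanSpace ℝ (Fin d)) e|} ⊆
      {u : 𝕊 d | ε < inner ℝ (u : EuclideanSpace ℝ (Fin d)) e} ∪
      {u : 𝕊 d | ε < inner ℝ (u : EuclideanSpace ℝ (Fin d)) (-e)} := by
    intro u hu
    simpa only [Set.mem_union, Set.mem_ofPred_eq, inner_neg_right, lt_abs] using hu
  refine (measure_mono hsub).trans ((measure_union_le _ _).trans ?_)
  rw [two_mul]
  exact add_le_add (uniformSphere_cap_le hd he hε hε1)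
    (uniformSphere_cap_le hd (by rwa [norm_neg]) hε hε1)

/-- By independence and Fubini, `v l` can be frozen and serves as the cap direction. -/
lemma pi_uniformSphere_abs_inner_le {n : ℕ} (hd : 0 < d) {i l : Fin n} (hil : i ≠ l) {ε : ℝ}
    (hε : 0 < ε) (hε1 : ε ^ 2 ≤ 1 / 2) :
    (Measure.pi fun _ : Fin n => uniformSphere d)
      {v | ε < |inner ℝ (v i : EuclideanSpace ℝ (Fin d)) (v l)|} ≤
      2 * ENNReal.ofReal (Real.exp (-(ε ^ 2 / 2)) ^ d) := by
  have hprob := isProbabilityMeasure_uniformSphere hd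
  set P := Measure.pi fun _ : Fin n => uniformSphere d with hP
  have hind : IndepFun (fun v : Fin n → 𝕊 d => v l) (fun v => v i) P :=
    (iIndepFun_pi (μ := fun _ : Fin n => uniformSphere d) (X := fun _ u => u)
      fun _ => aemeasurable_id).indepFun hil.symm
  have hmap := hind.map_prod_eq_prod_map_map (measurable_pi_apply l).aemeasurable
    (measurable_pi_apply i).aemeasurable
  have hl : P.map (fun v => v l) = uniformSphere d :=
    (measurePreserving_eval (fun _ : Fin n => uniformSphere d) l).map_eq
  have hi : P.map (fun v => v i) = uniformSphere d :=
    (measurePreserving_eval (fun _ : Fin n => uniformSphere d) i).map_eq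
  rw [hl, hi] at hmap
  have hB : MeasurableSet {x : (𝕊 d) × 𝕊 d |
      ε < |inner ℝ (x.2 : EuclideanSpace ℝ (Fin d)) x.1|} := by
    refine (isOpen_lt continuous_const ?_).measurableSet
    fun_prop
  have hpre : {v : Fin n → 𝕊 d | ε < |inner ℝ (v i : EuclideanSpace ℝ (Fin d)) (v l)|} =
      (fun v => (v l, v i)) ⁻¹' {x : (𝕊 d) × 𝕊 d |
        ε < |inner ℝ (x.2 : EuclideanSpace ℝ (Fin d)) x.1|} := rfl
  rw [hpre, ← Measure.map_apply (by fun_prop) hB, hmap, Measure.prod_apply hB]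
  calc _ ≤ ∫⁻ _ : 𝕊 d, 2 * ENNReal.ofReal (Real.exp (-(ε ^ 2 / 2)) ^ d) ∂uniformSphere d :=
        lintegral_mono fun u => uniformSphere_abs_inner_le hd (by simp) hε hε1
    _ = _ := by simp

/-- The matrices with rows of squared norms `w` and with inner products of distinct rows at most
`ε` times the product of their norms. -/
def almostOrthogonal {n : ℕ} (d : ℕ) (ε : ℝ) (w : Fin n → ℝ) : Set (Fin n → Fin d → ℝ) :=
  {M | (∀ i, ∑ j, M i j ^ 2 = w i) ∧
    ∀ i l, i ≠ l → |∑ j, M i j * M l j| ≤ ε * (√(w i) * √(w l))}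

lemma measurableSet_almostOrthogonal {n : ℕ} (ε : ℝ) (w : Fin n → ℝ) :
    MeasurableSet (almostOrthogonal d ε w) := by
  have : almostOrthogonal d ε w = (⋂ i, {M | ∑ j, M i j ^ 2 = w i}) ∩
      ⋂ i, ⋂ l, ⋂ _ : i ≠ l, {M | |∑ j, M i j * M l j| ≤ ε * (√(w i) * √(w l))} := by
    ext M
    simp [almostOrthogonal]
  rw [this]
  refine (IsClosed.inter (isClosed_iInter fun i => isClosed_eq (by fun_prop) continuous_const)
    (isClosed_iInter fun i => isClosed_iInter fun l => isClosed_iInter fun _ =>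
      isClosed_le (by fun_prop) continuous_const)).measurableSet

lemma spikedLaw_almostOrthogonal_compl_le {n : ℕ} (hd : 0 < d) (R : Finset (Fin n)) {ℓ : ℝ}
    (hℓ : 1 < ℓ) {ε : ℝ} (hε : 0 < ε) (hε1 : ε ^ 2 ≤ 1 / 2) :
    spikedLaw d R ℓ (almostOrthogonal d ε fun i => if i ∈ R then ℓ ^ 2 else 1)ᶜ ≤
      n * (n * (2 * ENNReal.ofReal (Real.exp (-(ε ^ 2 / 2)) ^ d))) := by
  have hprob := isProbabilityMeasure_uniformSphere hd
  rw [spikedLaw, Measure.map_apply ?_ (measurableSet_almostOrthogonal _ _).compl]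
  · set b : Fin n → ℝ := fun i => if i ∈ R then ℓ else 1 with hb
    have hb0 : ∀ i, 0 < b i := by
      intro i
      simp only [hb]
      split_ifs <;> linarith
    have hbw : ∀ i, (if i ∈ R then ℓ ^ 2 else 1) = b i ^ 2 := by
      intro i
      simp only [hb]
      split_ifs <;> simp
    have hsub : (fun (v : Fin n → 𝕊 d) i j => b i * (v i : EuclideanSpace ℝ (Fin d)) j) ⁻¹'
        (almostOrthogonal d ε fun i => if i ∈ R then ℓ ^ 2 else 1)ᶜ ⊆
        ⋃ i, ⋃ l, {v | i ≠ l ∧ ε < |inner ℝ (v i : EuclideanSpace ℝ (Fin d)) (v l)|} := by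
      intro v hv
      by_contra hcon
      simp only [Set.mem_iUnion, Set.mem_ofPred_eq, not_exists, not_and, not_lt] at hcon
      refine hv ⟨fun i => ?_, fun i l hil => ?_⟩
      · have h1 : ‖(v i : EuclideanSpace ℝ (Fin d))‖ = 1 := by simp
        have h2 := EuclideanSpace.real_norm_sq_eq (v i : EuclideanSpace ℝ (Fin d))
        rw [h1, one_pow] at h2
        simp only [mul_pow]
        rw [← Finset.mul_sum, ← h2, hbw, mul_one]
      · have h1 : ∑ j, b i * (v i : EuclideanSpace ℝ (Fin d)) j *
            (b l * (v l : EuclideanSpace ℝ (Fin d)) j) =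
            b i * b l * inner ℝ (v i : EuclideanSpace ℝ (Fin d)) (v l) := by
          rw [PiLp.inner_apply, Finset.mul_sum]
          refine Finset.sum_congr rfl fun j _ => ?_
          simp only [RCLike.inner_apply, conj_trivial]
          ring
        show |∑ j, b i * (v i : EuclideanSpace ℝ (Fin d)) j *
            (b l * (v l : EuclideanSpace ℝ (Fin d)) j)| ≤
          ε * (√(if i ∈ R then ℓ ^ 2 else 1) * √(if l ∈ R then ℓ ^ 2 else 1))
        rw [h1, hbw, hbw, Real.sqrt_sq (hb0 i).le, Real.sqrt_sq (hb0 l).le, abs_mul,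
          abs_of_pos (mul_pos (hb0 i) (hb0 l)), mul_comm]
        exact mul_le_mul_of_nonneg_right (hcon i l hil) (mul_pos (hb0 i) (hb0 l)).le
    refine (measure_mono hsub).trans ((measure_iUnion_fintype_le _ _).trans ?_)
    calc _ ≤ ∑ _i : Fin n, ∑ _l : Fin n,
          2 * ENNReal.ofReal (Real.exp (-(ε ^ 2 / 2)) ^ d) := by
          refine Finset.sum_le_sum fun i _ => (measure_iUnion_fintype_le _ _).trans
            (Finset.sum_le_sum fun l _ => ?_)
          by_cases hil : i = l
          · simp [hil]
          · simpa [hil] using pi_uniformSphere_abs_inner_le hd hil hε hε1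
      _ = _ := by simp
  · refine measurable_pi_lambda _ fun i => measurable_pi_lambda _ fun j => ?_
    refine Measurable.const_mul ?_ _
    have : Continuous fun v : Fin n → 𝕊 d => (v i : EuclideanSpace ℝ (Fin d)) j := by fun_prop
    exact this.measurable

end Sphere

/-! ### Failure probability in the spiked model. -/

lemma nearOrth_of_mem_almostOrthogonal {n d : ℕ} {ε : ℝ} (hε : 0 ≤ ε) {w : Fin n → ℝ}
    (hw : ∀ i, 0 ≤ w i) {M : Fin n → Fin d → ℝ} (hM : M ∈ almostOrthogonal d ε w) :
    NearOrth (n * ε) w (Matrix.of M) :=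
  nearOrth_of_inner_le hε hw hM.1 hM.2

lemma spiked_failure_bound {n d q : ℕ} {ℓ : ℝ} (hn : 2 ≤ n) (hℓ : 1 < ℓ)
    (hd : 20000 * ((q : ℝ) + 3) * (n : ℝ) ^ 6 * ℓ ^ 2 ≤ d) :
    n * (n * (2 * Real.exp (-((1 / (100 * (n : ℝ) ^ 2)) ^ 2 / 2)) ^ d)) ≤ 1 / (n : ℝ) ^ q := by
  have hn' : (2 : ℝ) ≤ n := by exact_mod_cast hn
  have hn0 : (0 : ℝ) < n := by linarith
  have hexp : Real.exp (-((1 / (100 * (n : ℝ) ^ 2)) ^ 2 / 2)) ^ d ≤ (1 / (n : ℝ)) ^ (q + 3) := by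
    calc _ = Real.exp (d * -((1 / (100 * (n : ℝ) ^ 2)) ^ 2 / 2)) := (Real.exp_nat_mul _ _).symm
      -- Of the `q + 3` powers of `1 / n`, two pay for the union over pairs of rows and one for the
      -- factor 2.
      _ ≤ Real.exp ((q + 3 : ℕ) * -(n : ℝ)) := by
        rw [Real.exp_le_exp, mul_neg, mul_neg, neg_le_neg_iff]
        have h1 : 20000 * ((q : ℝ) + 3) * (n : ℝ) ^ 6 * 1 ≤ d := by
          refine le_trans ?_ hd
          gcongr
          nlinarith
        have h2 : (d : ℝ) * ((1 / (100 * (n : ℝ) ^ 2)) ^ 2 / 2) =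
            d / (20000 * (n : ℝ) ^ 4) := by
          field_simp
          ring
        rw [h2, le_div_iff₀ (by positivity)]
        push_cast
        refine le_trans ?_ h1
        have h3 : (n : ℝ) ^ 5 ≤ (n : ℝ) ^ 6 :=
          pow_le_pow_right₀ (by linarith) (by norm_num)
        calc _ = 20000 * ((q : ℝ) + 3) * (n : ℝ) ^ 5 := by ring
          _ ≤ 20000 * ((q : ℝ) + 3) * (n : ℝ) ^ 6 := by gcongr
          _ = _ := (mul_one _).symm
      _ = (1 / Real.exp n) ^ (q + 3) := by
        rw [Real.exp_nat_mul, Real.exp_neg, one_div]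
      _ ≤ _ := by
        gcongr
        linarith [Real.add_one_le_exp (n : ℝ)]
  calc _ ≤ n * (n * (2 * (1 / (n : ℝ)) ^ (q + 3))) := by gcongr
    _ = 2 / n * (1 / (n : ℝ) ^ q) := by
      rw [pow_add, one_div_pow, one_div_pow]
      field_simp
    _ ≤ 1 * (1 / (n : ℝ) ^ q) := by
      gcongr
      rwa [div_le_one hn0]
    _ = _ := one_mul _

lemma spiked_failure_prob_le {n d k s q N : ℕ} {ℓ α : ℝ} (hk : 2 ≤ k) (hα : 0.7 < α) (hα1 : α < 1)
    (hs : (s : ℝ) = α * ((k : ℝ) - 1)) (hℓ1 : 1 < ℓ)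
    (hℓ : (4 * Real.exp 1 + 1) * (n : ℝ) / (α * (k : ℝ)) ≤ ℓ ^ 2)
    (hd : 20000 * ((q : ℝ) + 3) * (n : ℝ) ^ 6 * ℓ ^ 2 ≤ (d : ℝ))
    {R : Finset (Fin n)} (hR : R.card = s) (hN : 0 < N)
    {Ω : Type*} [MeasurableSpace Ω] (μ : Measure Ω) [IsProbabilityMeasure μ]
    {Tr : Fin N → Ω → Fin n → Fin d → ℝ} {A : Ω → Fin n → Fin d → ℝ}
    (hTr : ∀ a, HasLaw (Tr a) (spikedLaw d R ℓ) μ) (hA : HasLaw A (spikedLaw d R ℓ) μ) :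
    μ.real {ω | ¬ ∀ (π : Equiv.Perm (Fin n)) (p : Fin n → Fin k) (σ τ : Fin n → ℤˣ),
      IsGreedy k (fun a => Matrix.of (Tr a ω)) π p σ →
      sketchErr k (countSketch p σ) (Matrix.of (A ω)) ≤
        (1 - 1 / 20) * expectedRandomErr k k τ (Matrix.of (A ω))} ≤
      ((N : ℝ) + 1) / (n : ℝ) ^ q := by
  have hk' : (2 : ℝ) ≤ k := by exact_mod_cast hk
  have hn : 2 ≤ n := by
    have h1 := spike_count_bound hk (by rw [hs]; nlinarith) (by rw [hs]; nlinarith)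
    have h2 : (1 : ℝ) < s := by nlinarith
    have h3 : 1 < s := by exact_mod_cast h2
    have h4 := (Finset.card_le_univ R).trans_eq (Fintype.card_fin n)
    omega
  have hn0 : (0 : ℝ) < n := by
    have : 0 < n := by omega
    exact_mod_cast this
  have hd0 : 0 < d := by
    have : 0 < 20000 * ((q : ℝ) + 3) * (n : ℝ) ^ 6 * ℓ ^ 2 := by positivity
    exact_mod_cast this.trans_le hd
  set w : Fin n → ℝ := fun i => if i ∈ R then ℓ ^ 2 else 1 with hw
  have hw0 : ∀ i, 0 ≤ w i := by
    intro i
    simp only [hw]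
    split_ifs <;> positivity
  -- Makes `δ = n * ε` satisfy `δ * n = 1 / 100`, as the greedy step and the margin require.
  set ε : ℝ := 1 / (100 * (n : ℝ) ^ 2) with hε
  have hε0 : 0 < ε := by positivity
  have hn1 : (1 : ℝ) ≤ n := by exact_mod_cast (by omega : 1 ≤ n)
  have hδ : n * ε * n = 1 / 100 := by
    rw [hε]
    field_simp
  have hδ1 : n * ε ≤ 1 / 100 := by nlinarith [mul_pos hn0 hε0]
  have hε1 : ε ^ 2 ≤ 1 / 2 := by nlinarith
  set G := almostOrthogonal d ε w
  have hprob : ∀ X : Ω → Fin n → Fin d → ℝ, HasLaw X (spikedLaw d R ℓ) μ →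
      μ.real {ω | X ω ∈ Gᶜ} ≤ 1 / (n : ℝ) ^ q := by
    intro X hX
    have h1 : μ {ω | X ω ∈ Gᶜ} = spikedLaw d R ℓ Gᶜ :=
      hX.measure_eq (p := fun x => x ∈ Gᶜ) (measurableSet_almostOrthogonal ε w).compl
    have h2 := spikedLaw_almostOrthogonal_compl_le hd0 R hℓ1 hε0 hε1
    rw [measureReal_def, h1]
    refine ENNReal.toReal_le_of_le_ofReal (by positivity) (h2.trans ?_)
    refine le_trans (le_of_eq ?_) (ENNReal.ofReal_le_ofReal (spiked_failure_bound hn hℓ1 hd))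
    rw [ENNReal.ofReal_mul hn0.le, ENNReal.ofReal_mul hn0.le, ENNReal.ofReal_mul (by norm_num),
      ENNReal.ofReal_natCast, ENNReal.ofReal_ofNat]
  -- The failure event need not be measurable; it is covered by the events that some matrix is not
  -- almost orthogonal.
  have hsub : {ω | ¬ ∀ (π : Equiv.Perm (Fin n)) (p : Fin n → Fin k) (σ τ : Fin n → ℤˣ),
      IsGreedy k (fun a => Matrix.of (Tr a ω)) π p σ →
      sketchErr k (countSketch p σ) (Matrix.of (A ω)) ≤
        (1 - 1 / 20) * expectedRandomErr k k τ (Matrix.of (A ω))} ⊆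
      (⋃ a, {ω | Tr a ω ∈ Gᶜ}) ∪ {ω | A ω ∈ Gᶜ} := by
    intro ω hω
    by_contra hcon
    simp only [Set.mem_union, Set.mem_iUnion, Set.mem_ofPred_eq, Set.mem_compl_iff, not_or,
      not_exists, not_not] at hcon
    refine hω fun π p σ τ hgr => ?_
    exact spiked_greedy_le hk hα hα1 hs hℓ1 hℓ hR hN (mul_pos hn0 hε0).le hδ1 (by linarith)
      (fun a => nearOrth_of_mem_almostOrthogonal hε0.le hw0 (hcon.1 a))
      (nearOrth_of_mem_almostOrthogonal hε0.le hw0 hcon.2) (fun a i => (hcon.1 a).1 i) τ hgr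
  calc _ ≤ μ.real ((⋃ a, {ω | Tr a ω ∈ Gᶜ}) ∪ {ω | A ω ∈ Gᶜ}) := measureReal_mono hsub
    _ ≤ μ.real (⋃ a, {ω | Tr a ω ∈ Gᶜ}) + μ.real {ω | A ω ∈ Gᶜ} := measureReal_union_le _ _
    _ ≤ ∑ a, μ.real {ω | Tr a ω ∈ Gᶜ} + μ.real {ω | A ω ∈ Gᶜ} :=
      add_le_add_left (measureReal_iUnion_fintype_le _) _
    _ ≤ ∑ _a : Fin N, 1 / (n : ℝ) ^ q + 1 / (n : ℝ) ^ q :=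
      add_le_add (Finset.sum_le_sum fun a _ => hprob _ (hTr a)) (hprob _ hA)
    _ = _ := by
      rw [Finset.sum_const, Finset.card_univ, Fintype.card_fin, nsmul_eq_mul]
      ring

/-- There is one `η > 0` that serves both models. Sketches have `k` rows. -/
theorem mainTheorem1 :
    ∃ η : ℝ, 0 < η ∧
      -- Spiked covariance model: with high probability over the matrices drawn.
      (∀ q : ℕ, ∃ C : ℝ, 0 < C ∧
        ∀ (n d k s : ℕ) (ℓ α : ℝ), 2 ≤ k → 0.7 < α → α < 1 → (s : ℝ) = α * ((k : ℝ) - 1) →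
        1 < ℓ → (4 * Real.exp 1 + 1) * (n : ℝ) / (α * (k : ℝ)) ≤ ℓ ^ 2 →
        C * (n : ℝ) ^ 6 * ℓ ^ 2 ≤ (d : ℝ) →
        ∀ R : Finset (Fin n), R.card = s →
        ∀ (N : ℕ), 0 < N →
        ∀ (Ω : Type*) [MeasurableSpace Ω] (μ : Measure Ω) [IsProbabilityMeasure μ]
          (Tr : Fin N → Ω → Fin n → Fin d → ℝ) (A : Ω → Fin n → Fin d → ℝ),
        (∀ a, HasLaw (Tr a) (spikedLaw d R ℓ) μ) → HasLaw A (spikedLaw d R ℓ) μ →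
        μ.real {ω | ¬ ∀ (π : Equiv.Perm (Fin n)) (p : Fin n → Fin k) (σ τ : Fin n → ℤˣ),
          IsGreedy k (fun a => Matrix.of (Tr a ω)) π p σ →
          sketchErr k (countSketch p σ) (Matrix.of (A ω)) ≤
            (1 - η) * expectedRandomErr k k τ (Matrix.of (A ω))} ≤
          ((N : ℝ) + 1) / (n : ℝ) ^ q) ∧
      -- Zipfian model: for all matrices of the family.
      (∃ k₀ : ℕ, ∀ k ≥ k₀, ∀ (n d h : ℕ) (c : Fin n → ℕ), IsZipfProfile h c →
        ∀ (N : ℕ), 0 < N →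
        ∀ (Tr : Fin N → Matrix (Fin n) (Fin d) ℝ) (A : Matrix (Fin n) (Fin d) ℝ),
        (∀ a, IsZipf c (Tr a)) → IsZipf c A →
        ∀ (π : Equiv.Perm (Fin n)) (p : Fin n → Fin k) (σ τ : Fin n → ℤˣ),
          IsGreedy k Tr π p σ →
          sketchErr k (countSketch p σ) A ≤ (1 - η) * expectedRandomErr k k τ A) := by
  refine ⟨1 / 20, by norm_num, fun q => ⟨20000 * ((q : ℝ) + 3), by positivity, ?_⟩, 2 ^ 50, ?_⟩
  · intro n d k s ℓ α hk hα hα1 hs hℓ1 hℓ hd R hR N hN Ω _ μ _ Tr A hTr hA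
    exact spiked_failure_prob_le hk hα hα1 hs hℓ1 hℓ hd hR hN μ hTr hA
  · intro k hk n d h c hc N hN Tr A hTr hA π p σ τ hG
    exact zipf_greedy_le hk hc hN hTr hA τ hG
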